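/- Let $m,p,b>0$ with $mp>1$, let $0<T\le+\infty$, and let $u_0:\mathbb{R}\to[0,\infty)$ be continuous with $\sup\{x:u_0(x)>0\}=0$ and $$u_0(x)\sim C(-x)_+^{\alpha}\quad\text{as }x\to0^-,\qquad\text{for some }C>0,\ \alpha>0 .$$ Let $u=u(x,t)\ge 0$ be a strong solution, continuous on $\mathbb{R}\times[0,T)$, of the Cauchy problem $$u_t-\Big(|(u^{m})_x|^{p-1}(u^{m})_x\Big)_x+bu^{\beta}=0,\quad x\in\mathbb{R},\ 0<t<T,\qquad u(x,0)=u_0(x),$$ that is: for every interval $I=(a,\infty)$, $a\in\mathbb{R}$, one has $u\in C([0,T);L^1(I))\cap L^\infty(I\times[\delta,T))$ for all $\delta>0$; $u^m(\cdot,t)\in W^{1,\infty}(I)$ for a.e. $t\in(0,T)$; $u_t$ and $(|(u^m)_x|^{p-1}(u^m)_x)_x$ belong to $L^1_{loc}(0,T;L^1(I))$; and the equation holds a.e. (This includes every continuous strong solution with $u_0\in L^1(\mathbb{R})$, for which the same holds with $I=\mathbb{R}$, and it puts no restriction on the growth of $u_0$ as $x\to-\infty$.) Let $\eta(t)=\sup\{x:u(x,t)>0\}$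 be its interface, so that $\eta(0)=0$. If $\alpha\ge\frac{1+p}{mp-1}$ and $\beta\ge1$, then the interface initially remains stationary: there is $\delta\in(0,T)$ such that $\eta(t)=0$ for all $t\in[0,\delta]$. -/

import Mathlib

open MeasureTheory Set Filter Topology
open scoped ContDiff ENNReal

/-- The open time interval `(0, T)`, with `0 < T ≤ +∞`. -/
def timeIoo (T : EReal) : Set ℝ := {t : ℝ | 0 < t ∧ (t : EReal) < T}

/-- The time interval `[0, T)`, with `0 < T ≤ +∞`. -/
def timeIco (T : EReal) : Set ℝ := {t : ℝ | 0 ≤ t ∧ (t : EReal) < T}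

/-- `g` is the weak derivative of `f` on the open set `I ⊆ ℝ`. -/
def HasWeakDerivOn (I : Set ℝ) (f g : ℝ → ℝ) : Prop :=
  LocallyIntegrableOn f I ∧ LocallyIntegrableOn g I ∧
    ∀ φ : ℝ → ℝ, ContDiff ℝ ∞ φ → HasCompactSupport φ → tsupport φ ⊆ I →
      ∫ x, f x * deriv φ x = - ∫ x, g x * φ x

/-- The weak derivative `g` exists, and `f ∈ W^{1,∞}(I)`. -/
def HasWeakDerivWOneInf (I : Set ℝ) (f g : ℝ → ℝ) : Prop :=
  MemLp f ∞ (volume.restrict I) ∧ MemLp g ∞ (volume.restrict I) ∧ HasWeakDerivOn I f g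

/-- `f ∈ L¹_loc(0, T; L¹(I))`, for a function `f x t` of space and time. -/
def MemL1locL1 (T : EReal) (I : Set ℝ) (f : ℝ → ℝ → ℝ) : Prop :=
  ∀ s t : ℝ, s ∈ timeIoo T → t ∈ timeIoo T →
    IntegrableOn (fun z : ℝ × ℝ => f z.1 z.2) (I ×ˢ Icc s t)

/-- `u` (a function `u x t` of space and time) is a nonnegative strong solution, on the open
interval `I`, of `u_t - (|(u^m)_x|^{p-1} (u^m)_x)_x + b u^β = 0`, `0 < t < T`, `u(·, 0) = u₀`.
For `I = ℝ` this is the usual notion of a strong solution of the Cauchy problem; `u` is the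
continuous representative, so that its values at points make sense. -/
structure IsStrongSolutionOn (m p b β : ℝ) (T : EReal) (I : Set ℝ) (u₀ : ℝ → ℝ)
    (u : ℝ → ℝ → ℝ) : Prop where
  nonneg : ∀ x ∈ I, ∀ t ∈ timeIco T, 0 ≤ u x t
  continuousOn : ContinuousOn (fun z : ℝ × ℝ => u z.1 z.2) (I ×ˢ timeIco T)
  initial : ∀ x ∈ I, u x 0 = u₀ x
  /-- `u ∈ C([0, T); L¹(I))`: integrability. -/
  integrableOn : ∀ t ∈ timeIco T, IntegrableOn (fun x => u x t) I
  /-- `u ∈ C([0, T); L¹(I))`: continuity. -/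
  continuous_L1 : ∀ t ∈ timeIco T,
    Tendsto (fun s => ∫ x in I, |u x s - u x t|) (𝓝[timeIco T] t) (𝓝 0)
  /-- `u ∈ L^∞(I × [δ, T))` for every `δ > 0`. -/
  bounded : ∀ δ : ℝ, 0 < δ → ∃ M : ℝ, ∀ x ∈ I, ∀ t ∈ timeIco T, δ ≤ t → u x t ≤ M
  /-- There are functions `v = (u^m)_x`, `ut = u_t` and `q = (|(u^m)_x|^{p-1} (u^m)_x)_x` (weak
  derivatives) with `u^m(·, t) ∈ W^{1,∞}(I)` for a.e. `t`, with `ut` and `q` in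
  `L¹_loc(0, T; L¹(I))`, such that the equation holds almost everywhere. -/
  strong : ∃ v ut q : ℝ → ℝ → ℝ,
    (∀ᵐ t ∂(volume.restrict (timeIoo T)),
      HasWeakDerivWOneInf I (fun x => u x t ^ m) (fun x => v x t)) ∧
    (∀ᵐ x ∂(volume.restrict I), HasWeakDerivOn (timeIoo T) (fun t => u x t) (fun t => ut x t)) ∧
    (∀ᵐ t ∂(volume.restrict (timeIoo T)),
      HasWeakDerivOn I (fun x => |v x t| ^ (p - 1) * v x t) (fun x => q x t)) ∧
    MemL1locL1 T I ut ∧ MemL1locL1 T I q ∧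
    ∀ᵐ z ∂(volume.restrict (I ×ˢ timeIoo T)),
      ut z.1 z.2 - q z.1 z.2 + b * u z.1 z.2 ^ β = 0

/-- Strong solution of the Cauchy problem on the whole line (with data in `L¹(ℝ)`). -/
def IsStrongSolution (m p b β : ℝ) (T : EReal) (u₀ : ℝ → ℝ) (u : ℝ → ℝ → ℝ) : Prop :=
  IsStrongSolutionOn m p b β T univ u₀ u

/-- Solution of the Cauchy problem for data that need be integrable only on the right half-lines
`(a, ∞)`, with no restriction on the growth as `x → -∞`: the requirements on a strong solution are
imposed on every right half-line. Every strong solution on `ℝ` is a solution in this sense,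
see `IsStrongSolution.isSolution`. -/
def IsSolution (m p b β : ℝ) (T : EReal) (u₀ : ℝ → ℝ) (u : ℝ → ℝ → ℝ) : Prop :=
  ∀ a : ℝ, IsStrongSolutionOn m p b β T (Ioi a) u₀ u

theorem HasWeakDerivOn.mono {I J : Set ℝ} (h : J ⊆ I) {f g : ℝ → ℝ}
    (H : HasWeakDerivOn I f g) : HasWeakDerivOn J f g :=
  ⟨H.1.mono_set h, H.2.1.mono_set h, fun φ h1 h2 h3 => H.2.2 φ h1 h2 (h3.trans h)⟩

theorem HasWeakDerivWOneInf.mono {I J : Set ℝ} (h : J ⊆ I) {f g : ℝ → ℝ}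
    (H : HasWeakDerivWOneInf I f g) : HasWeakDerivWOneInf J f g :=
  ⟨H.1.mono_measure (Measure.restrict_mono h le_rfl),
    H.2.1.mono_measure (Measure.restrict_mono h le_rfl), H.2.2.mono h⟩

theorem IsStrongSolutionOn.mono {m p b β : ℝ} {T : EReal} {I J : Set ℝ} (h : J ⊆ I)
    {u₀ : ℝ → ℝ} {u : ℝ → ℝ → ℝ} (H : IsStrongSolutionOn m p b β T I u₀ u) :
    IsStrongSolutionOn m p b β T J u₀ u where
  nonneg x hx := H.nonneg x (h hx)
  continuousOn := H.continuousOn.mono (prod_mono h le_rfl)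
  initial x hx := H.initial x (h hx)
  integrableOn t ht := (H.integrableOn t ht).mono_set h
  continuous_L1 t ht := by
    refine squeeze_zero' (.of_forall fun s => integral_nonneg fun x => abs_nonneg _) ?_
      (H.continuous_L1 t ht)
    filter_upwards [self_mem_nhdsWithin] with s hs
    exact setIntegral_mono_set ((H.integrableOn s hs).sub (H.integrableOn t ht)).abs
      (.of_forall fun x => abs_nonneg _) (.of_forall h)
  bounded δ hδ := by
    obtain ⟨M, hM⟩ := H.bounded δ hδ
    exact ⟨M, fun x hx => hM x (h hx)⟩
  strong := by
    obtain ⟨v, ut, q, h1, h2, h3, h4, h5, h6⟩ := H.strong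
    refine ⟨v, ut, q, ?_, ?_, ?_, ?_, ?_, ?_⟩
    · exact h1.mono fun t ht => ht.mono h
    · exact ae_mono (Measure.restrict_mono h le_rfl) h2
    · exact h3.mono fun t ht => ht.mono h
    · exact fun s t hs ht => (h4 s t hs ht).mono_set (prod_mono h le_rfl)
    · exact fun s t hs ht => (h5 s t hs ht).mono_set (prod_mono h le_rfl)
    · exact ae_mono (Measure.restrict_mono (prod_mono h le_rfl) le_rfl) h6

theorem IsStrongSolution.isSolution {m p b β : ℝ} {T : EReal} {u₀ : ℝ → ℝ} {u : ℝ → ℝ → ℝ}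
    (H : IsStrongSolution m p b β T u₀ u) : IsSolution m p b β T u₀ u :=
  fun a => IsStrongSolutionOn.mono (subset_univ (Ioi a)) H

/-- The interface `η(t) = sup {x : u(x, t) > 0}`, as an extended real number (`⊥` if `u(·, t)`
vanishes identically, `⊤` if its positivity set is unbounded to the right). -/
noncomputable def interface (u : ℝ → ℝ → ℝ) (t : ℝ) : EReal :=
  sSup ((fun x : ℝ => (x : EReal)) '' {x : ℝ | 0 < u x t})

/-! Stationarity of the interface splits into two one-sided bounds, each obtained by comparing `u`
with an explicit barrier of the form `e^{κt} h(x)`.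

No advance: with `γ = (1+p)/(mp-1)`, diffusion maps `A (-x)_+^γ` to a constant multiple of itself.
Since `α ≥ γ`, the data lie below such a profile near `0`, and letting it grow like `e^{κt}` gives a
supersolution for a short time, absorption only helping. Comparison on a half-line `(c, ∞)` then
forces `u = 0` for `x > 0` (`IsSolution.exists_waitingTime`).

No retreat: as `β ≥ 1`, absorption on a bounded range of values is at most linear. A small bump
decaying like `e^{κt}`, `κ ≤ 0`, is a subsolution, so every initially positive point stays positive
(`IsSolution.pos_of_initial_pos`).

Both comparisons are `L¹` arguments: the difference of the equations is integrated over the set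
where the excess is positive. On that set the diffusive part contributes only boundary terms,
because `|v|^(p-1) v` is monotone in `v` (`integral_indicator_deriv_le`); hence the mass of the
excess does not increase (`integral_max_zero_le`), and it tends to `0` as `t → 0`. To compute with a
strong solution, its weak derivatives are first turned into absolutely continuous slices. -/

/-! ### Weak derivatives and absolutely continuous representatives -/

theorem exists_Icc_of_isCompact_subset_Ioo {K : Set ℝ} (hK : IsCompact K) {c d : ℝ} (hcd : c < d)
    (h : K ⊆ Ioo c d) : ∃ c' d', c < c' ∧ c' ≤ d' ∧ d' < d ∧ K ⊆ Icc c' d' := by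
  rcases K.eq_empty_or_nonempty with rfl | hne
  · exact ⟨(c + d) / 2, (c + d) / 2, by linarith, le_rfl, by linarith, empty_subset _⟩
  · obtain ⟨y, hy⟩ := hK.exists_isLeast hne
    obtain ⟨z, hz⟩ := hK.exists_isGreatest hne
    exact ⟨y, z, (h hy.1).1, hy.2 hz.1, (h hz.1).2, fun w hw => ⟨hy.2 hw, hz.2 hw⟩⟩

/-- A compactly supported smooth function with vanishing integral has a compactly supported smooth
primitive. -/
theorem exists_primitive_of_integral_eq_zero {c d : ℝ} (hcd : c < d) {θ : ℝ → ℝ}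
    (hθ : ContDiff ℝ ∞ θ) (hc : HasCompactSupport θ) (hs : tsupport θ ⊆ Ioo c d)
    (h0 : ∫ x, θ x = 0) :
    ∃ φ : ℝ → ℝ, ContDiff ℝ ∞ φ ∧ HasCompactSupport φ ∧ tsupport φ ⊆ Ioo c d ∧ deriv φ = θ := by
  obtain ⟨c', d', h1, h2, h3, h4⟩ := exists_Icc_of_isCompact_subset_Ioo hc hcd hs
  have hz : ∀ x, x ∉ Icc c' d' → θ x = 0 := fun x hx =>
    image_eq_zero_of_notMem_tsupport fun h => hx (h4 h)
  have hd : ∀ x, HasDerivAt (fun x => ∫ y in c..x, θ y) (θ x) x := fun x =>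
    hθ.continuous.integral_hasStrictDerivAt c x |>.hasDerivAt
  have hderiv : deriv (fun x => ∫ y in c..x, θ y) = θ := funext fun x => (hd x).deriv
  have hsupp : ∀ x, x ∉ Icc c' d' → ∫ y in c..x, θ y = 0 := by
    intro x hx
    rcases not_and_or.mp hx with h | h
    · rw [not_le] at h
      refine intervalIntegral.integral_zero_ae (.of_forall fun y hy => hz y fun hy' => ?_)
      rcases hy with ⟨-, h6⟩
      have : max c x < c' := max_lt h1 h
      linarith [hy'.1]
    · rw [not_le] at h
      have : ∫ y in c..x, θ y = ∫ y, θ y := by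
        rw [intervalIntegral.integral_of_le (by linarith)]
        refine setIntegral_eq_integral_of_forall_compl_eq_zero fun y hy => hz y fun hy' => hy ?_
        exact ⟨by linarith [hy'.1], by linarith [hy'.2]⟩
      rw [this, h0]
  have hts : tsupport (fun x => ∫ y in c..x, θ y) ⊆ Icc c' d' :=
    closure_minimal (fun x hx => by_contra fun h => hx (hsupp x h)) isClosed_Icc
  refine ⟨fun x => ∫ y in c..x, θ y, ?_, ?_, ?_, hderiv⟩
  · rw [contDiff_infty_iff_deriv, hderiv]
    exact ⟨fun x => (hd x).differentiableAt, hθ⟩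
  · exact isCompact_Icc.of_isClosed_subset (isClosed_tsupport _) hts
  · exact hts.trans fun x hx => ⟨by linarith [hx.1], by linarith [hx.2]⟩

/-- Du Bois-Reymond: a function whose weak derivative vanishes is constant. -/
theorem ae_eq_const_of_integral_mul_deriv_eq_zero {c d : ℝ} (hcd : c < d) {h : ℝ → ℝ}
    (hh : IntegrableOn h (Ioo c d))
    (H : ∀ φ : ℝ → ℝ, ContDiff ℝ ∞ φ → HasCompactSupport φ → tsupport φ ⊆ Ioo c d →
      ∫ x, h x * deriv φ x = 0) :
    ∃ K, ∀ᵐ x, x ∈ Ioo c d → h x = K := by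
  -- A fixed bump of unit mass inside `(c, d)`. Subtracting `(∫ ψ) r` from a test function `ψ` makes
  -- its integral vanish, hence makes it a derivative; the constant must then be `∫ h r`.
  let ρ : ContDiffBump ((c + d) / 2) := ⟨(d - c) / 8, (d - c) / 4, by linarith, by linarith⟩
  set r : ℝ → ℝ := ρ.normed volume with hr
  have hr1 : ContDiff ℝ ∞ r := ρ.contDiff_normed
  have hr2 : HasCompactSupport r := ρ.hasCompactSupport_normed
  have hr3 : tsupport r ⊆ Ioo c d := by
    rw [hr, ρ.tsupport_normed_eq, Real.closedBall_eq_Icc]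
    intro x hx
    have h1 := hx.1
    have h2 := hx.2
    change (c + d) / 2 - (d - c) / 4 ≤ x at h1
    change x ≤ (c + d) / 2 + (d - c) / 4 at h2
    constructor <;> linarith
  have hr4 : ∫ x, r x = 1 := ρ.integral_normed
  have key : ∀ ψ : ℝ → ℝ, Continuous ψ → HasCompactSupport ψ → tsupport ψ ⊆ Ioo c d →
      Integrable fun x => h x * ψ x := by
    intro ψ h1 h2 h3
    obtain ⟨B, hB⟩ := h1.bounded_above_of_compact_support h2
    have : Integrable fun x => (Ioo c d).indicator h x * ψ x :=
      ((integrable_indicator_iff measurableSet_Ioo).mpr hh).mul_bdd (c := B)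
        h1.aestronglyMeasurable (.of_forall hB)
    refine this.congr (.of_forall fun x => ?_)
    by_cases hx : x ∈ Ioo c d
    · simp [hx]
    · simp [hx, image_eq_zero_of_notMem_tsupport fun h => hx (h3 h)]
  refine ⟨∫ x, h x * r x, ?_⟩
  have := isOpen_Ioo.ae_eq_zero_of_integral_contDiff_smul_eq_zero (μ := volume)
    (f := fun x => h x - ∫ x, h x * r x) (U := Ioo c d) ?_ ?_
  · filter_upwards [this] with x hx h'
    linarith [hx h']
  · refine IntegrableOn.locallyIntegrableOn (hh.sub ?_)
    exact integrableOn_const (by simp)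
  · intro ψ h1 h2 h3
    obtain ⟨φ, p1, p2, p3, p4⟩ := exists_primitive_of_integral_eq_zero hcd
      (θ := fun x => ψ x - (∫ x, ψ x) * r x) (h1.sub (contDiff_const.mul hr1))
      (h2.sub hr2.mul_left)
      ((tsupport_sub _ _).trans (union_subset h3 ((tsupport_mul_subset_right).trans hr3))) (by
        rw [integral_sub (h1.continuous.integrable_of_hasCompactSupport h2)
          ((hr1.continuous.integrable_of_hasCompactSupport hr2).const_mul _),
          integral_const_mul, hr4]
        ring)
    have h5 := H φ p1 p2 p3
    rw [p4] at h5
    have e1 := key ψ h1.continuous h2 h3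
    have e2 := key r hr1.continuous hr2 hr3
    have : ∫ x, h x * (ψ x - (∫ x, ψ x) * r x) =
        ∫ x, (h x * ψ x - (∫ x, ψ x) * (h x * r x)) := by
      congr 1; ext x; ring
    rw [this, integral_sub e1 (e2.const_mul _), integral_const_mul] at h5
    have : ∫ x, ψ x • (h x - ∫ x, h x * r x) =
        ∫ x, (h x * ψ x - (∫ x, h x * r x) * ψ x) := by
      congr 1; ext x; rw [smul_eq_mul]; ring
    rw [this, integral_sub e1
      ((h1.continuous.integrable_of_hasCompactSupport h2).const_mul _), integral_const_mul]
    linarith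

/-- `f` is absolutely continuous on `[c, d]` with almost everywhere derivative `g`. -/
def HasACDeriv (f g : ℝ → ℝ) (c d : ℝ) : Prop :=
  AbsolutelyContinuousOnInterval f c d ∧ ∀ᵐ x, x ∈ Ioo c d → HasDerivAt f (g x) x

theorem ae_mem_Ioo_of_mem_uIoc {c d : ℝ} (hcd : c ≤ d) : ∀ᵐ x : ℝ, x ∈ uIoc c d → x ∈ Ioo c d := by
  have : ∀ᵐ x : ℝ, x ≠ d := by simp [ae_iff, measure_singleton]
  filter_upwards [this] with x hx h
  rw [uIoc_of_le hcd] at h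
  exact ⟨h.1, lt_of_le_of_ne h.2 hx⟩

namespace HasACDeriv

variable {f g f₁ g₁ : ℝ → ℝ} {c d : ℝ}

theorem ae_deriv_eq (h : HasACDeriv f g c d) (hcd : c ≤ d) :
    ∀ᵐ x, x ∈ uIoc c d → deriv f x = g x := by
  filter_upwards [h.2, ae_mem_Ioo_of_mem_uIoc hcd] with x hx h' h''
  exact (hx (h' h'')).deriv

theorem intervalIntegrable (h : HasACDeriv f g c d) (hcd : c ≤ d) :
    IntervalIntegrable g volume c d :=
  h.1.intervalIntegrable_deriv.congr_ae
    ((ae_restrict_iff' measurableSet_uIoc).mpr (h.ae_deriv_eq hcd))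

theorem integral_eq_sub (h : HasACDeriv f g c d) (hcd : c ≤ d) :
    ∫ x in c..d, g x = f d - f c := by
  rw [← h.1.integral_deriv_eq_sub]
  exact (intervalIntegral.integral_congr_ae (h.ae_deriv_eq hcd)).symm

theorem sub (h : HasACDeriv f g c d) (h₁ : HasACDeriv f₁ g₁ c d) :
    HasACDeriv (fun x => f x - f₁ x) (fun x => g x - g₁ x) c d := by
  refine ⟨h.1.fun_sub h₁.1, ?_⟩
  filter_upwards [h.2, h₁.2] with x h1 h2 hx
  exact (h1 hx).sub (h2 hx)

theorem of_hasDerivAt (h : ∀ x, HasDerivAt f (g x) x) (hg : Continuous g) :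
    HasACDeriv f g c d := by
  have hd : deriv f = g := funext fun x => (h x).deriv
  have : ContDiff ℝ 1 f := by
    rw [contDiff_one_iff_deriv, hd]
    exact ⟨fun x => (h x).differentiableAt, hg⟩
  exact ⟨this.contDiffOn.absolutelyContinuousOnInterval, .of_forall fun x _ => h x⟩

theorem of_eq_integral {K : ℝ} (hcd : c ≤ d) (hg : IntervalIntegrable g volume c d)
    (hf : ∀ x ∈ Icc c d, f x = K + ∫ y in c..x, g y) : HasACDeriv f g c d := by
  constructor
  · have h1 := hg.absolutelyContinuousOnInterval_intervalIntegral (c := c) (by simp)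
    have h2 : AbsolutelyContinuousOnInterval (fun _ : ℝ => K) c d :=
      contDiff_const.contDiffOn.absolutelyContinuousOnInterval
    have h3 := h2.fun_add h1
    rw [absolutelyContinuousOnInterval_iff] at h3 ⊢
    intro ε hε
    obtain ⟨δ, hδ, H⟩ := h3 ε hε
    refine ⟨δ, hδ, fun E hE hE' => ?_⟩
    rw [Finset.sum_congr rfl fun i hi => ?_]
    · exact H E hE hE'
    · have := hE.1 i hi
      rw [uIcc_of_le hcd] at this
      rw [hf _ this.1, hf _ this.2]
  · filter_upwards [hg.ae_hasDerivAt_integral] with x hx h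
    have h1 := hx (by rw [uIcc_of_le hcd]; exact Ioo_subset_Icc_self h) c (by simp)
    have h2 : HasDerivAt (fun x => K + ∫ y in c..x, g y) (g x) x := h1.const_add K
    refine h2.congr_of_eventuallyEq ?_
    filter_upwards [Icc_mem_nhds h.1 h.2] with y hy using hf y hy

end HasACDeriv

theorem LipschitzWith.comp_absolutelyContinuousOnInterval {H : ℝ → ℝ} {K : NNReal}
    (hH : LipschitzWith K H) {f : ℝ → ℝ} {c d : ℝ} (hf : AbsolutelyContinuousOnInterval f c d) :
    AbsolutelyContinuousOnInterval (fun x => H (f x)) c d := by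
  have h2 := Tendsto.const_mul (K : ℝ) hf
  rw [mul_zero] at h2
  refine squeeze_zero (fun E => Finset.sum_nonneg fun _ _ => dist_nonneg) (fun E => ?_) h2
  rw [Finset.mul_sum]
  exact Finset.sum_le_sum fun i _ => hH.dist_le_mul _ _

/-- Integration by parts shows that `f` minus the primitive of `g` is orthogonal to every `φ'`, so
Du Bois-Reymond applies to the difference. -/
theorem HasWeakDerivOn.exists_ae_eq {I : Set ℝ} {f g : ℝ → ℝ} (H : HasWeakDerivOn I f g)
    {c d : ℝ} (hcd : c < d) (hI : Icc c d ⊆ I) :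
    ∃ K, ∀ᵐ x, x ∈ Ioo c d → f x = K + ∫ y in c..x, g y := by
  have hf := H.1.integrableOn_compact_subset hI isCompact_Icc
  have hg := H.2.1.integrableOn_compact_subset hI isCompact_Icc
  have hg' : IntervalIntegrable g volume c d :=
    (intervalIntegrable_iff_integrableOn_Icc_of_le hcd.le).mpr hg
  have hG : HasACDeriv (fun x => ∫ y in c..x, g y) g c d :=
    HasACDeriv.of_eq_integral (K := 0) hcd.le hg' (by simp)
  have hGc := hG.1.continuousOn
  rw [uIcc_of_le hcd.le] at hGc
  have hGi : IntegrableOn (fun x => ∫ y in c..x, g y) (Icc c d) := hGc.integrableOn_Icc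
  obtain ⟨K, hK⟩ := ae_eq_const_of_integral_mul_deriv_eq_zero hcd
    (h := fun x => f x - ∫ y in c..x, g y) ((hf.sub hGi).mono_set Ioo_subset_Icc_self) (by
    intro φ h1 h2 h3
    have hz : ∀ x, x ∉ Ioo c d → φ x = 0 := fun x hx =>
      image_eq_zero_of_notMem_tsupport fun h => hx (h3 h)
    have hz' : ∀ x, x ∉ Ioo c d → deriv φ x = 0 := fun x hx =>
      image_eq_zero_of_notMem_tsupport fun h => hx (h3 (tsupport_deriv_subset (𝕜 := ℝ) h))
    have h4 := H.2.2 φ h1 h2 (h3.trans (Ioo_subset_Icc_self.trans hI))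
    have hφ : HasACDeriv φ (deriv φ) c d := HasACDeriv.of_hasDerivAt
      (fun x => (h1.differentiable (by simp)).differentiableAt.hasDerivAt)
      (h1.continuous_deriv (by simp))
    have h5 := hG.1.integral_mul_deriv_eq_deriv_mul hφ.1
    rw [hz d (by simp), hz c (by simp)] at h5
    have e1 : ∀ F : ℝ → ℝ, ∫ x in c..d, F x * deriv φ x = ∫ x, F x * deriv φ x := fun F => by
      rw [intervalIntegral.integral_of_le hcd.le]
      refine setIntegral_eq_integral_of_forall_compl_eq_zero fun x hx => ?_
      rw [hz' x fun h => hx (Ioo_subset_Ioc_self h), mul_zero]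
    have e2 : ∫ x in c..d, deriv (fun x => ∫ y in c..x, g y) x * φ x = ∫ x, g x * φ x := by
      rw [intervalIntegral.integral_congr_ae (g := fun x => g x * φ x)]
      · rw [intervalIntegral.integral_of_le hcd.le]
        refine setIntegral_eq_integral_of_forall_compl_eq_zero fun x hx => ?_
        rw [hz x fun h => hx (Ioo_subset_Ioc_self h), mul_zero]
      · filter_upwards [hG.ae_deriv_eq hcd.le] with x hx h
        rw [hx h]
    rw [e1, e2] at h5
    have e3 : ∀ F : ℝ → ℝ, IntegrableOn F (Icc c d) → IntegrableOn (fun x => F x * deriv φ x)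
        (Ioc c d) := fun F hF =>
      ((intervalIntegrable_iff_integrableOn_Ioc_of_le hcd.le).mp
        (((intervalIntegrable_iff_integrableOn_Icc_of_le hcd.le).mpr hF).mul_continuousOn
          (h1.continuous_deriv (by simp)).continuousOn))
    rw [← e1, intervalIntegral.integral_of_le hcd.le]
    simp_rw [sub_mul]
    rw [integral_sub (e3 f hf) (e3 _ hGi), ← intervalIntegral.integral_of_le hcd.le,
      ← intervalIntegral.integral_of_le hcd.le, e1, e1, h4, h5]
    ring)
  refine ⟨K, ?_⟩
  filter_upwards [hK] with x hx h
  linarith [hx h]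

theorem eqOn_Icc_of_ae_eq {c d : ℝ} (hcd : c < d) {f g : ℝ → ℝ} (hf : ContinuousOn f (Icc c d))
    (hg : ContinuousOn g (Icc c d)) (h : ∀ᵐ x, x ∈ Ioo c d → f x = g x) :
    EqOn f g (Icc c d) := by
  have h1 : EqOn f g (Ioo c d) :=
    Measure.eqOn_open_of_ae_eq ((ae_restrict_iff' measurableSet_Ioo).mpr h) isOpen_Ioo
      (hf.mono Ioo_subset_Icc_self) (hg.mono Ioo_subset_Icc_self)
  exact h1.of_subset_closure hf hg Ioo_subset_Icc_self (by rw [closure_Ioo hcd.ne])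

/-- A continuous function with a weak derivative is absolutely continuous. -/
theorem HasWeakDerivOn.hasACDeriv {I : Set ℝ} {f g : ℝ → ℝ} (H : HasWeakDerivOn I f g)
    {c d : ℝ} (hcd : c ≤ d) (hI : Icc c d ⊆ I) (hf : ContinuousOn f (Icc c d)) :
    HasACDeriv f g c d := by
  rcases hcd.eq_or_lt with rfl | hcd
  · exact HasACDeriv.of_eq_integral (K := f c) le_rfl (by simp) (by simp +contextual)
  obtain ⟨K, hK⟩ := H.exists_ae_eq hcd hI
  have hg' : IntervalIntegrable g volume c d :=
    (intervalIntegrable_iff_integrableOn_Icc_of_le hcd.le).mpr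
      (H.2.1.integrableOn_compact_subset hI isCompact_Icc)
  have hG : HasACDeriv (fun x => K + ∫ y in c..x, g y) g c d :=
    HasACDeriv.of_eq_integral hcd.le hg' (fun _ _ => rfl)
  have hGc := hG.1.continuousOn
  rw [uIcc_of_le hcd.le] at hGc
  exact HasACDeriv.of_eq_integral hcd.le hg' (eqOn_Icc_of_ae_eq hcd hf hGc hK)

/-- A weakly differentiable function on a half-line has a locally absolutely continuous
representative. -/
theorem HasWeakDerivOn.exists_hasACDeriv {a c : ℝ} {f g : ℝ → ℝ} (H : HasWeakDerivOn (Ioi a) f g)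
    (hc : a < c) :
    ∃ F : ℝ → ℝ, (∀ d, c ≤ d → HasACDeriv F g c d) ∧ ∀ᵐ x, c < x → f x = F x := by
  have hsub : ∀ d, Icc c d ⊆ Ioi a := fun d x hx => hc.trans_le hx.1
  have hex : ∀ n : ℕ, ∃ K, ∀ᵐ x, x ∈ Ioo c (c + n + 1) → f x = K + ∫ y in c..x, g y := fun n =>
    H.exists_ae_eq (by have : (0 : ℝ) ≤ n := n.cast_nonneg
                       linarith) (hsub _)
  choose K hK using hex
  -- All the intervals contain `(c, c + 1)`, so their constants agree and a single primitive serves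
  -- the whole half-line.
  have hKK : ∀ n, K n = K 0 := by
    intro n
    have h : ∀ᵐ x, x ∈ Ioo c (c + 1) → K n = K 0 := by
      filter_upwards [hK n, hK 0] with x h1 h2 hx
      have : (0 : ℝ) ≤ n := n.cast_nonneg
      have h3 := h1 ⟨hx.1, by linarith [hx.2]⟩
      have h4 := h2 ⟨hx.1, by push_cast; linarith [hx.2]⟩
      linarith
    have h' : ∃ x : ℝ, x ∈ Ioo c (c + 1) ∧ (x ∈ Ioo c (c + 1) → K n = K 0) := by
      have hne : (volume.restrict (Ioo c (c + 1))) ≠ 0 := by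
        simp [Measure.restrict_eq_zero]
      have : (ae (volume.restrict (Ioo c (c + 1)))).NeBot := ae_neBot.mpr hne
      obtain ⟨x, hx⟩ := ((ae_restrict_of_ae (s := Ioo c (c + 1)) h).and
        (ae_restrict_mem measurableSet_Ioo)).exists
      exact ⟨x, hx.2, hx.1⟩
    obtain ⟨x, hx, hx'⟩ := h'
    exact hx' hx
  refine ⟨fun x => K 0 + ∫ y in c..x, g y, fun d hd => ?_, ?_⟩
  · refine HasACDeriv.of_eq_integral hd ?_ (fun _ _ => rfl)
    exact (intervalIntegrable_iff_integrableOn_Icc_of_le hd).mpr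
      (H.2.1.integrableOn_compact_subset (hsub d) isCompact_Icc)
  · filter_upwards [ae_all_iff.mpr hK] with x hx h
    obtain ⟨n, hn⟩ := exists_nat_gt (x - c)
    rw [hx n ⟨h, by linarith⟩, hKK n]

/-! ### Truncation, and integration over positivity sets -/

/-- Only zeros of `f` need an argument: there the truncation has a minimum, so its derivative, where
it exists, is `0`. -/
theorem HasACDeriv.max_zero {f g : ℝ → ℝ} {c d : ℝ} (h : HasACDeriv f g c d) (hcd : c ≤ d) :
    HasACDeriv (fun x => max (f x) 0) ({x | 0 < f x}.indicator g) c d := by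
  have hl : LipschitzWith 1 fun y : ℝ => max y 0 := LipschitzWith.id.max_const 0
  have hac := hl.comp_absolutelyContinuousOnInterval h.1
  refine ⟨hac, ?_⟩
  filter_upwards [h.2, hac.ae_differentiableAt] with x h1 h2 hx
  have h1 := h1 hx
  have h2 := (h2 (by rw [uIcc_of_le hcd]; exact Ioo_subset_Icc_self hx)).hasDerivAt
  rcases lt_trichotomy (f x) 0 with h0 | h0 | h0
  · rw [indicator_of_notMem (by simpa using h0.le)]
    refine (hasDerivAt_const x (0 : ℝ)).congr_of_eventuallyEq ?_
    filter_upwards [h1.continuousAt.eventually_lt_const h0] with y hy using max_eq_right hy.le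
  · rw [indicator_of_notMem (by simp [h0])]
    have hmin : IsLocalMin (fun x => max (f x) 0) x :=
      .of_forall fun y => by simp [h0]
    rwa [hmin.hasDerivAt_eq_zero h2] at h2
  · rw [indicator_of_mem (by simpa using h0)]
    refine h1.congr_of_eventuallyEq ?_
    filter_upwards [h1.continuousAt.eventually_const_lt h0] with y hy using max_eq_left hy.le

/-- A substitute for the chain rule where `H` may fail to be differentiable at `g x`. Monotonicity
gives `ψ'` and `g'` compatible signs, and the Lipschitz bound makes `ψ'` vanish when `g'` does. -/
theorem mul_nonneg_of_hasDerivAt_comp {H g : ℝ → ℝ} {K : NNReal} {x g' ψ' F : ℝ}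
    (hm : Monotone H) (hH : LipschitzWith K H) (hg : HasDerivAt g g' x)
    (hψ : HasDerivAt (fun y => H (g y)) ψ' x) (hF : 0 ≤ F * g') : 0 ≤ F * ψ' := by
  have t1 := hasDerivAt_iff_tendsto_slope.mp hg
  have t2 := hasDerivAt_iff_tendsto_slope.mp hψ
  have h1 : 0 ≤ ψ' * g' := by
    refine ge_of_tendsto' (t2.mul t1) fun y => ?_
    have h : 0 ≤ (H (g y) - H (g x)) * (g y - g x) := by
      rcases le_total (g y) (g x) with h | h
      · exact mul_nonneg_of_nonpos_of_nonpos (by linarith [hm h]) (by linarith)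
      · exact mul_nonneg (by linarith [hm h]) (by linarith)
    simp only [slope_def_field]
    rw [div_mul_div_comm]
    exact div_nonneg h (mul_self_nonneg _)
  have h2 : |ψ'| ≤ K * |g'| := by
    refine le_of_tendsto_of_tendsto' t2.abs (t1.abs.const_mul _) fun y => ?_
    have h := hH.dist_le_mul (g y) (g x)
    rw [Real.dist_eq, Real.dist_eq] at h
    simp only [slope_def_field, abs_div, ← mul_div_assoc]
    exact div_le_div_of_nonneg_right h (abs_nonneg _)
  rcases lt_trichotomy g' 0 with h | h | h
  · exact mul_nonneg_of_nonpos_of_nonpos (nonpos_of_mul_nonneg_left hF h)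
      (nonpos_of_mul_nonneg_left h1 h)
  · rw [h, abs_zero, mul_zero] at h2
    rw [abs_nonpos_iff.mp h2, mul_zero]
  · exact mul_nonneg (nonneg_of_mul_nonneg_left hF h) (nonneg_of_mul_nonneg_left h1 h)

/-- If the flux `F` has everywhere the sign of the derivative of `g`, then its net outflow from the
set where `g` is positive is controlled by the boundary. -/
theorem integral_indicator_deriv_le {F F' g g' : ℝ → ℝ} {c d B : ℝ} (hcd : c ≤ d)
    (hF : HasACDeriv F F' c d) (hg : HasACDeriv g g' c d)
    (hmono : ∀ᵐ x, x ∈ Ioo c d → 0 ≤ F x * g' x) (hc : g c ≤ 0) (hB : 0 ≤ B)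
    (hd : g d ≤ 0 ∨ F d ≤ B) :
    ∫ x in c..d, {x | 0 < g x}.indicator F' x ≤ B := by
  -- Lipschitz approximations of the Heaviside function, zero for `y ≤ 0`, so that `H n ∘ g` tends
  -- to the indicator of `{g > 0}` with the zero set excluded.
  let H : ℕ → ℝ → ℝ := fun n y => max (min (n * y) 1) 0
  have Hmono : ∀ n, Monotone (H n) := fun n x y hxy =>
    max_le_max (min_le_min (mul_le_mul_of_nonneg_left hxy n.cast_nonneg) le_rfl) le_rfl
  have Hlip : ∀ n : ℕ, LipschitzWith (n : NNReal) (H n) := fun n => by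
    have : LipschitzWith (n : NNReal) fun y : ℝ => (n : ℝ) * y :=
      LipschitzWith.of_dist_le_mul fun x y => by
        rw [Real.dist_eq, Real.dist_eq, ← mul_sub, abs_mul]; simp
    exact (this.min_const 1).max_const 0
  have H0 : ∀ n y, y ≤ 0 → H n y = 0 := fun n y hy =>
    max_eq_right ((min_le_left _ _).trans (mul_nonpos_of_nonneg_of_nonpos n.cast_nonneg hy))
  have Hnn : ∀ n y, 0 ≤ H n y := fun n y => le_max_right _ _
  have Hle : ∀ n y, H n y ≤ 1 := fun n y => max_le (min_le_right _ _) zero_le_one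
  have Hac : ∀ n, AbsolutelyContinuousOnInterval (fun x => H n (g x)) c d := fun n =>
    (Hlip n).comp_absolutelyContinuousOnInterval hg.1
  have hFi := hF.intervalIntegrable hcd
  have bound : ∀ n, ∫ x in c..d, F' x * H n (g x) ≤ B := by
    intro n
    have h1 := hF.1.integral_mul_deriv_eq_deriv_mul (Hac n)
    have h2 : 0 ≤ ∫ x in c..d, F x * deriv (fun x => H n (g x)) x := by
      rw [intervalIntegral.integral_of_le hcd]
      refine integral_nonneg_of_ae ?_
      rw [EventuallyLE, ae_restrict_iff' measurableSet_Ioc]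
      filter_upwards [hg.2, (Hac n).ae_differentiableAt, hmono, ae_mem_Ioo_of_mem_uIoc hcd]
        with x e1 e2 e3 e4 hx
      have hx' := e4 (by rwa [uIoc_of_le hcd])
      exact mul_nonneg_of_hasDerivAt_comp (Hmono n) (Hlip n) (e1 hx')
        (e2 (by rw [uIcc_of_le hcd]; exact Ioo_subset_Icc_self hx')).hasDerivAt (e3 hx')
    have h3 : ∫ x in c..d, deriv F x * H n (g x) = ∫ x in c..d, F' x * H n (g x) := by
      refine intervalIntegral.integral_congr_ae ?_
      filter_upwards [hF.ae_deriv_eq hcd] with x hx h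
      rw [hx h]
    rw [H0 n _ hc, h3] at h1
    have h4 : F d * H n (g d) ≤ B := by
      rcases hd with h | h
      · rw [H0 n _ h, mul_zero]; exact hB
      · calc F d * H n (g d) ≤ B * H n (g d) := mul_le_mul_of_nonneg_right h (Hnn _ _)
          _ ≤ B * 1 := mul_le_mul_of_nonneg_left (Hle _ _) hB
          _ = B := mul_one B
    linarith
  refine le_of_tendsto' (x := atTop) (f := fun n : ℕ => ∫ x in c..d, F' x * H n (g x)) ?_ bound
  refine intervalIntegral.tendsto_integral_filter_of_dominated_convergence (fun x => |F' x|)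
    (.of_forall fun n => ?_) (.of_forall fun n => .of_forall fun x hx => ?_) hFi.abs
    (.of_forall fun x hx => ?_)
  · exact (hFi.mul_continuousOn (Hac n).continuousOn).aestronglyMeasurable_restrict_uIoc
  · rw [norm_mul, Real.norm_eq_abs, Real.norm_eq_abs, abs_of_nonneg (Hnn _ _)]
    exact mul_le_of_le_one_right (abs_nonneg _) (Hle _ _)
  · by_cases h : 0 < g x
    · rw [indicator_of_mem (by simpa using h)]
      refine tendsto_const_nhds.congr' ?_
      obtain ⟨N, hN⟩ := exists_nat_gt (1 / g x)
      filter_upwards [eventually_ge_atTop N] with n hn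
      have h1 : (1 : ℝ) ≤ n * g x := by
        rw [← div_le_iff₀ h]
        exact hN.le.trans (Nat.cast_le.mpr hn)
      change F' x = F' x * max (min (n * g x) 1) 0
      rw [min_eq_right h1, max_eq_left zero_le_one, mul_one]
    · rw [indicator_of_notMem (by simpa using h)]
      refine tendsto_const_nhds.congr fun n => ?_
      rw [H0 n _ (not_lt.mp h), mul_zero]

/-- The mass of the positive part of `G` does not increase when the total rate of change of `G` on
the set where it is positive is almost always nonpositive. -/
theorem integral_max_zero_le {J : Set ℝ} (hJ : MeasurableSet J) {G Gt : ℝ → ℝ → ℝ} {s t : ℝ}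
    (hst : s ≤ t) (hac : ∀ᵐ x ∂(volume.restrict J), HasACDeriv (G x) (Gt x) s t)
    (hGc : ContinuousOn (fun z : ℝ × ℝ => G z.1 z.2) (J ×ˢ Icc s t))
    (hGt : IntegrableOn (fun z : ℝ × ℝ => Gt z.1 z.2) (J ×ˢ Icc s t))
    (hs : IntegrableOn (fun x => max (G x s) 0) J) (ht : IntegrableOn (fun x => max (G x t) 0) J)
    (hle : ∀ᵐ τ ∂(volume.restrict (Ioo s t)),
      ∫ x in J, {x | 0 < G x τ}.indicator (fun x => Gt x τ) x ≤ 0) :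
    ∫ x in J, max (G x t) 0 ≤ ∫ x in J, max (G x s) 0 := by
  have hD : MeasurableSet (J ×ˢ Icc s t) := hJ.prod measurableSet_Icc
  have hP : IntegrableOn ({z : ℝ × ℝ | 0 < G z.1 z.2}.indicator fun z => Gt z.1 z.2)
      (J ×ˢ Icc s t) := by
    -- `G` is continuous only on the domain; its positivity set agrees there with an open `U`, which
    -- supplies measurability.
    obtain ⟨U, hU, hU'⟩ := (continuousOn_iff'.mp hGc) (Ioi 0) isOpen_Ioi
    have h1 : IntegrableOn (U.indicator fun z => Gt z.1 z.2) (J ×ˢ Icc s t) :=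
      hGt.indicator hU.measurableSet
    refine h1.congr_fun (fun z hz => ?_) hD
    have h2 : 0 < G z.1 z.2 ↔ z ∈ U := by
      have := Set.ext_iff.mp hU' z
      simpa [hz] using this
    by_cases h : z ∈ U
    · rw [indicator_of_mem h, indicator_of_mem (by simpa using h2.mpr h)]
    · rw [indicator_of_notMem h, indicator_of_notMem (by simpa using fun h' => h (h2.mp h'))]
  rw [IntegrableOn, Measure.volume_eq_prod, ← Measure.prod_restrict] at hP
  have h1 : ∫ x in J, (max (G x t) 0 - max (G x s) 0) =
      ∫ x in J, ∫ τ in Icc s t, {z : ℝ × ℝ | 0 < G z.1 z.2}.indicator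
        (fun z => Gt z.1 z.2) (x, τ) := by
    refine integral_congr_ae ?_
    filter_upwards [hac] with x hx
    rw [← (hx.max_zero hst).integral_eq_sub hst, intervalIntegral.integral_of_le hst,
      integral_Icc_eq_integral_Ioc]
    rfl
  have h2 := integral_integral_swap (f := fun x τ => {z : ℝ × ℝ | 0 < G z.1 z.2}.indicator
        (fun z => Gt z.1 z.2) (x, τ)) hP
  rw [h2, integral_sub ht hs, integral_Icc_eq_integral_Ioo] at h1
  have h3 : ∫ τ in Ioo s t, ∫ x in J, {z : ℝ × ℝ | 0 < G z.1 z.2}.indicator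
        (fun z => Gt z.1 z.2) (x, τ) ≤ 0 := integral_nonpos_of_ae hle
  linarith

/-! ### The odd power nonlinearity -/

/-- The odd power function `v ↦ |v|^(p-1) v`. -/
noncomputable def signedPow (p v : ℝ) : ℝ := |v| ^ (p - 1) * v

theorem signedPow_of_nonneg {p v : ℝ} (hp : 0 < p) (hv : 0 ≤ v) : signedPow p v = v ^ p := by
  rcases hv.eq_or_lt with rfl | hv
  · simp [signedPow, Real.zero_rpow hp.ne']
  · rw [signedPow, abs_of_pos hv, Real.rpow_sub_one hv.ne', div_mul_cancel₀ _ hv.ne']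

theorem signedPow_neg (p v : ℝ) : signedPow p (-v) = -signedPow p v := by
  simp [signedPow]

theorem signedPow_zero (p : ℝ) : signedPow p 0 = 0 := by simp [signedPow]

theorem signedPow_monotone {p : ℝ} (hp : 0 < p) : Monotone (signedPow p) := by
  refine monotone_of_odd_of_monotoneOn_nonneg (signedPow_neg p) fun x hx y hy hxy => ?_
  rw [signedPow_of_nonneg hp hx, signedPow_of_nonneg hp hy]
  exact Real.rpow_le_rpow hx hxy hp.le

theorem signedPow_mul {p r v : ℝ} (hp : 0 < p) (hr : 0 ≤ r) :
    signedPow p (r * v) = r ^ p * signedPow p v := by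
  rcases le_total 0 v with hv | hv
  · rw [signedPow_of_nonneg hp hv, signedPow_of_nonneg hp (mul_nonneg hr hv), Real.mul_rpow hr hv]
  · have hv' : 0 ≤ -v := by linarith
    have h := Real.mul_rpow hr hv' (z := p)
    rw [← signedPow_of_nonneg hp hv', ← signedPow_of_nonneg hp (mul_nonneg hr hv'), mul_neg,
      signedPow_neg, signedPow_neg] at h
    linarith

theorem signedPow_sub_mul_sub_nonneg {p : ℝ} (hp : 0 < p) (x y : ℝ) :
    0 ≤ (signedPow p x - signedPow p y) * (x - y) := by
  rcases le_total x y with h | h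
  · exact mul_nonneg_of_nonpos_of_nonpos (by linarith [signedPow_monotone hp h]) (by linarith)
  · exact mul_nonneg (by linarith [signedPow_monotone hp h]) (by linarith)

theorem signedPow_signedPow_inv {p : ℝ} (hp : 0 < p) (v : ℝ) :
    signedPow p (signedPow (1 / p) v) = v := by
  have key : ∀ v, 0 ≤ v → signedPow p (signedPow (1 / p) v) = v := fun v hv => by
    rw [signedPow_of_nonneg (by positivity) hv, signedPow_of_nonneg hp (by positivity),
      ← Real.rpow_mul hv, one_div_mul_cancel hp.ne', Real.rpow_one]
  rcases le_total 0 v with hv | hv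
  · exact key v hv
  · have h := key (-v) (by linarith)
    rw [signedPow_neg, signedPow_neg] at h
    linarith

/-! ### Slices of a strong solution in space and time -/

theorem HasACDeriv.mono {f g : ℝ → ℝ} {c d c' d' : ℝ} (h : HasACDeriv f g c d) (hc : c ≤ c')
    (hcd : c' ≤ d') (hd : d' ≤ d) : HasACDeriv f g c' d' := by
  refine ⟨h.1.mono ?_, ?_⟩
  · rw [uIcc_of_le hcd, uIcc_of_le (hc.trans (hcd.trans hd))]
    exact Icc_subset_Icc hc hd
  · filter_upwards [h.2] with x hx h' using hx ⟨hc.trans_lt h'.1, h'.2.trans_le hd⟩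

theorem measurableSet_timeIoo (T : EReal) : MeasurableSet (timeIoo T) :=
  (measurableSet_lt measurable_const measurable_id).inter
    (measurableSet_lt measurable_coe_real_ereal measurable_const)

theorem Icc_subset_timeIoo {T : EReal} {s t : ℝ} (hs : 0 < s) (ht : (t : EReal) < T) :
    Icc s t ⊆ timeIoo T := fun _ hx =>
  ⟨hs.trans_le hx.1, (EReal.coe_le_coe_iff.mpr hx.2).trans_lt ht⟩

theorem Icc_subset_timeIco {T : EReal} {s t : ℝ} (hs : 0 ≤ s) (ht : (t : EReal) < T) :
    Icc s t ⊆ timeIco T := fun _ hx =>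
  ⟨hs.trans hx.1, (EReal.coe_le_coe_iff.mpr hx.2).trans_lt ht⟩

theorem IsStrongSolutionOn.continuousOn_space {m p b β : ℝ} {T : EReal} {I : Set ℝ} {u₀ : ℝ → ℝ}
    {u : ℝ → ℝ → ℝ} (H : IsStrongSolutionOn m p b β T I u₀ u) {t : ℝ} (ht : t ∈ timeIco T) :
    ContinuousOn (fun x => u x t) I :=
  H.continuousOn.comp (Continuous.prodMk_left t).continuousOn fun _ hx => ⟨hx, ht⟩

theorem IsStrongSolutionOn.continuousOn_time {m p b β : ℝ} {T : EReal} {I : Set ℝ} {u₀ : ℝ → ℝ}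
    {u : ℝ → ℝ → ℝ} (H : IsStrongSolutionOn m p b β T I u₀ u) {x : ℝ} (hx : x ∈ I) :
    ContinuousOn (fun t => u x t) (timeIco T) :=
  H.continuousOn.comp (Continuous.prodMk_right x).continuousOn fun _ ht => ⟨hx, ht⟩

/-- The absolutely continuous slices of a strong solution: `v`, `ut`, `q` are the derivatives
`(u^m)_x`, `u_t` and `(|(u^m)_x|^(p-1) (u^m)_x)_x`. -/
structure HasSlices (m p b β : ℝ) (T : EReal) (c : ℝ) (u v ut q : ℝ → ℝ → ℝ) : Prop where
  pressure : ∀ᵐ t ∂(volume.restrict (timeIoo T)), ∀ d, c ≤ d →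
    HasACDeriv (fun x => u x t ^ m) (fun x => v x t) c d
  flux : ∀ᵐ t ∂(volume.restrict (timeIoo T)), ∃ F : ℝ → ℝ,
    (∀ d, c ≤ d → HasACDeriv F (fun x => q x t) c d) ∧ ∀ᵐ x, c < x → signedPow p (v x t) = F x
  equation : ∀ᵐ t ∂(volume.restrict (timeIoo T)), ∀ᵐ x, c < x →
    ut x t = q x t - b * u x t ^ β
  time : ∀ᵐ x, c < x → ∀ s t : ℝ, 0 < s → s ≤ t → (t : EReal) < T → HasACDeriv (u x) (ut x) s t
  integrable_ut : ∀ s t : ℝ, 0 < s → s ≤ t → (t : EReal) < T →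
    IntegrableOn (fun z : ℝ × ℝ => ut z.1 z.2) (Ioi c ×ˢ Icc s t)
  integrable_q : ∀ s t : ℝ, 0 < s → s ≤ t → (t : EReal) < T →
    IntegrableOn (fun z : ℝ × ℝ => q z.1 z.2) (Ioi c ×ˢ Icc s t)

theorem IsStrongSolutionOn.exists_hasSlices {m p b β : ℝ} {T : EReal} {a : ℝ} {u₀ : ℝ → ℝ}
    {u : ℝ → ℝ → ℝ} (H : IsStrongSolutionOn m p b β T (Ioi a) u₀ u) (hm : 0 < m) {c : ℝ}
    (hac : a < c) : ∃ v ut q, HasSlices m p b β T c u v ut q := by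
  obtain ⟨v, ut, q, h1, h2, h3, h4, h5, h6⟩ := H.strong
  have hsub : Ioi c ⊆ Ioi a := Ioi_subset_Ioi hac.le
  have htime : ∀ s t : ℝ, 0 < s → s ≤ t → (t : EReal) < T → s ∈ timeIoo T ∧ t ∈ timeIoo T :=
    fun s t hs hst ht => ⟨Icc_subset_timeIoo hs ht ⟨le_rfl, hst⟩,
      Icc_subset_timeIoo hs ht ⟨hst, le_rfl⟩⟩
  refine ⟨v, ut, q, ⟨?_, ?_, ?_, ?_, ?_, ?_⟩⟩
  · filter_upwards [h1, ae_restrict_mem (measurableSet_timeIoo T)] with t ht ht' d hd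
    have hI : Icc c d ⊆ Ioi a := fun x hx => hac.trans_le hx.1
    exact ht.2.2.hasACDeriv hd hI (((H.continuousOn_space ⟨ht'.1.le, ht'.2⟩).mono hI).rpow_const
      fun _ _ => .inr hm.le)
  · filter_upwards [h3] with t ht
    exact ht.exists_hasACDeriv hac
  · rw [Measure.volume_eq_prod, ← Measure.prod_restrict] at h6
    have h7 := Measure.ae_ae_of_ae_prod ((Measure.measurePreserving_swap
      (μ := volume.restrict (timeIoo T))
      (ν := volume.restrict (Ioi a))).quasiMeasurePreserving.ae h6)
    filter_upwards [h7] with t ht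
    filter_upwards [(ae_restrict_iff' measurableSet_Ioi).mp ht] with x hx hx'
    have := hx (hsub hx')
    simp only [Prod.swap] at this
    linarith
  · filter_upwards [(ae_restrict_iff' measurableSet_Ioi).mp h2] with x hx hx' s t hs hst ht
    exact (hx (hsub hx')).hasACDeriv hst (Icc_subset_timeIoo hs ht)
      ((H.continuousOn_time (hsub hx')).mono (Icc_subset_timeIco hs.le ht))
  · intro s t hs hst ht
    exact (h4 s t (htime s t hs hst ht).1 (htime s t hs hst ht).2).mono_set
      (prod_mono hsub le_rfl)
  · intro s t hs hst ht
    exact (h5 s t (htime s t hs hst ht).1 (htime s t hs hst ht).2).mono_set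
      (prod_mono hsub le_rfl)

/-! ### Behaviour at the initial time and at infinity -/

/-- A function whose excess mass over the initial data is nonincreasing in time stays nonpositive.
-/
theorem IsStrongSolutionOn.nonpos_of_mass_le {m p b β : ℝ} {T : EReal} {J : Set ℝ} {u₀ : ℝ → ℝ}
    {u : ℝ → ℝ → ℝ} (H : IsStrongSolutionOn m p b β T J u₀ u) (hJ : IsOpen J) {t : ℝ}
    (ht : 0 < t) (htT : (t : EReal) < T) {G : ℝ → ℝ → ℝ}
    (hc : ContinuousOn (fun x => G x t) J) (hi : IntegrableOn (fun x => max (G x t) 0) J)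
    (hmass : ∀ s, 0 < s → s ≤ t → ∫ x in J, max (G x t) 0 ≤ ∫ x in J, max (G x s) 0)
    (hle : ∀ s, 0 < s → s ≤ t → ∀ x ∈ J, max (G x s) 0 ≤ |u x s - u x 0|) :
    ∀ x ∈ J, G x t ≤ 0 := by
  have h0 : (0 : ℝ) ∈ timeIco T := Icc_subset_timeIco le_rfl htT ⟨le_rfl, ht.le⟩
  have hsub : Ioc 0 t ⊆ timeIco T := fun s hs => Icc_subset_timeIco le_rfl htT ⟨hs.1.le, hs.2⟩
  -- The mass inequality is available only from `s > 0`, as `u_t` is integrable only on compact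
  -- subintervals of `(0, T)`; `L¹` continuity at `0` bridges the gap.
  have hlim : Tendsto (fun s => ∫ x in J, |u x s - u x 0|) (𝓝[Ioc 0 t] 0) (𝓝 0) :=
    (H.continuous_L1 0 h0).mono_left (nhdsWithin_mono _ hsub)
  have hne : (𝓝[Ioc 0 t] (0 : ℝ)).NeBot := by
    rw [nhdsWithin_Ioc_eq_nhdsGT ht]; infer_instance
  have hz : ∫ x in J, max (G x t) 0 ≤ 0 := by
    refine ge_of_tendsto hlim ?_
    filter_upwards [self_mem_nhdsWithin] with s hs
    refine (hmass s hs.1 hs.2).trans ?_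
    refine integral_mono_of_nonneg (.of_forall fun x => le_max_right _ _)
      ((H.integrableOn s (hsub hs)).sub (H.integrableOn 0 h0)).abs ?_
    exact (ae_restrict_iff' hJ.measurableSet).mpr (.of_forall (hle s hs.1 hs.2))
  have hz' := (setIntegral_eq_zero_iff_of_nonneg_ae (.of_forall fun x => le_max_right _ _) hi).mp
    (le_antisymm hz (integral_nonneg fun x => le_max_right _ _))
  have heq := Measure.eqOn_open_of_ae_eq hz' hJ
    (ContinuousOn.sup hc continuousOn_const) continuousOn_const
  intro x hx
  exact max_eq_right_iff.mp (heq hx)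

/-- The flux of a bounded nonnegative pressure has no positive limit at infinity. -/
theorem flux_limit_nonpos {p : ℝ} (hp : 0 < p) {c B L : ℝ} {g v F : ℝ → ℝ}
    (hg : ∀ d, c ≤ d → HasACDeriv g v c d) (hF : ∀ᵐ x, c < x → signedPow p (v x) = F x)
    (hL : Tendsto F atTop (𝓝 L)) (h0 : ∀ x, c < x → 0 ≤ g x) (hB : ∀ x, c < x → g x ≤ B) :
    L ≤ 0 := by
  by_contra! h
  obtain ⟨R, hR⟩ := eventually_atTop.mp
    ((hL.eventually_const_lt (half_lt_self h)).and (eventually_gt_atTop c))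
  -- If `L > 0`, the slope of `g` is eventually at least `k`, with `k^p = L/2`. Over a length `(B +
  -- 1)/k` this raises `g` by at least `B + 1`, more than the bounds `0 ≤ g ≤ B` allow.
  set k := (L / 2) ^ (1 / p) with hk
  have hkpos : 0 < k := by positivity
  have hRc : c < R := (hR R le_rfl).2
  have hv : ∀ᵐ x, R < x → k ≤ v x := by
    filter_upwards [hF] with x hx hRx
    have h1 := (hR x hRx.le).1
    rw [← hx (hRc.trans hRx)] at h1
    by_contra! h2
    have h3 := signedPow_monotone hp h2.le
    rw [signedPow_of_nonneg hp hkpos.le, hk, ← Real.rpow_mul (by positivity),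
      one_div_mul_cancel hp.ne', Real.rpow_one] at h3
    linarith
  have hBn : 0 ≤ B := (h0 R hRc).trans (hB R hRc)
  have hd : R ≤ R + (B + 1) / k := by
    have : 0 ≤ (B + 1) / k := by positivity
    linarith
  have hac := (hg _ (hRc.le.trans hd)).mono hRc.le hd le_rfl
  have h1 : ∫ x in R..(R + (B + 1) / k), k ≤ ∫ x in R..(R + (B + 1) / k), v x := by
    refine intervalIntegral.integral_mono_ae_restrict hd (by simp) (hac.intervalIntegrable hd) ?_
    rw [EventuallyLE, ae_restrict_iff' measurableSet_Icc]
    have : ∀ᵐ x : ℝ, x ≠ R := by simp [ae_iff, measure_singleton]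
    filter_upwards [hv, this] with x hx hne h
    exact hx (lt_of_le_of_ne h.1 (Ne.symm hne))
  rw [hac.integral_eq_sub hd, intervalIntegral.integral_const, smul_eq_mul,
    add_sub_cancel_left, div_mul_cancel₀ _ hkpos.ne'] at h1
  linarith [h0 R hRc, hB _ (hRc.trans_le hd)]

/-! ### Barriers and comparison -/

/-- A nonnegative function `W` with `Wt = W_t`, `V = (W^m)_x`, `Q = (|V|^(p-1) V)_x` in the
classical sense. -/
structure IsBarrier (m p : ℝ) (W Wt V Q : ℝ → ℝ → ℝ) : Prop where
  nonneg : ∀ x t, 0 ≤ W x t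
  continuous : Continuous fun z : ℝ × ℝ => W z.1 z.2
  continuous_time_deriv : Continuous fun z : ℝ × ℝ => Wt z.1 z.2
  hasDerivAt_time : ∀ x t, HasDerivAt (W x) (Wt x t) t
  hasDerivAt_pressure : ∀ x t, HasDerivAt (fun x => W x t ^ m) (V x t) x
  continuous_pressure_deriv : ∀ t, Continuous fun x => V x t
  hasDerivAt_flux : ∀ x t, HasDerivAt (fun x => signedPow p (V x t)) (Q x t) x
  continuous_flux_deriv : ∀ t, Continuous fun x => Q x t

namespace IsBarrier

variable {m p : ℝ} {W Wt V Q : ℝ → ℝ → ℝ}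

theorem hasACDeriv_time (h : IsBarrier m p W Wt V Q) (x s t : ℝ) :
    HasACDeriv (W x) (Wt x) s t :=
  HasACDeriv.of_hasDerivAt (h.hasDerivAt_time x)
    (h.continuous_time_deriv.comp (Continuous.prodMk_right x))

theorem hasACDeriv_pressure (h : IsBarrier m p W Wt V Q) (t c d : ℝ) :
    HasACDeriv (fun x => W x t ^ m) (fun x => V x t) c d :=
  HasACDeriv.of_hasDerivAt (fun x => h.hasDerivAt_pressure x t) (h.continuous_pressure_deriv t)

theorem hasACDeriv_flux (h : IsBarrier m p W Wt V Q) (t c d : ℝ) :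
    HasACDeriv (fun x => signedPow p (V x t)) (fun x => Q x t) c d :=
  HasACDeriv.of_hasDerivAt (fun x => h.hasDerivAt_flux x t) (h.continuous_flux_deriv t)

theorem continuous_space (h : IsBarrier m p W Wt V Q) (t : ℝ) : Continuous fun x => W x t :=
  h.continuous.comp (Continuous.prodMk_left t)

end IsBarrier

theorem ae_prod_slice_integrable {J : Set ℝ} {s t : ℝ} {f : ℝ → ℝ → ℝ}
    (h : IntegrableOn (fun z : ℝ × ℝ => f z.1 z.2) (J ×ˢ Icc s t)) :
    ∀ᵐ τ ∂(volume.restrict (Ioo s t)), IntegrableOn (fun x => f x τ) J := by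
  rw [IntegrableOn, Measure.volume_eq_prod, ← Measure.prod_restrict] at h
  exact ae_mono (Measure.restrict_mono Ioo_subset_Icc_self le_rfl) h.prod_left_ae

/-- The flux is monotone in the derivative of `u^m`, whereas mass is measured by `u`; this
equivalence lets one positivity set serve both. -/
theorem rpow_sub_rpow_pos_iff {m a b : ℝ} (hm : 0 < m) (ha : 0 ≤ a) (hb : 0 ≤ b) :
    0 < a ^ m - b ^ m ↔ 0 < a - b := by
  rw [sub_pos, sub_pos]
  exact Real.rpow_lt_rpow_iff hb ha hm

theorem integrableOn_indicator_pos {J : Set ℝ} (hJ : IsOpen J) {g f : ℝ → ℝ}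
    (hg : ContinuousOn g J) (hf : IntegrableOn f J) :
    IntegrableOn ({x | 0 < g x}.indicator f) J := by
  have hU : IsOpen (J ∩ g ⁻¹' Ioi 0) := hg.isOpen_inter_preimage hJ isOpen_Ioi
  refine (hf.indicator hU.measurableSet).congr_fun (fun x hx => ?_) hJ.measurableSet
  by_cases h : 0 < g x
  · rw [indicator_of_mem (show x ∈ J ∩ g ⁻¹' Ioi 0 from ⟨hx, h⟩),
      indicator_of_mem (by simpa using h)]
  · rw [indicator_of_notMem (fun h' => h h'.2), indicator_of_notMem (by simpa using h)]

/-- The absorption of `u` has a favourable sign and is discarded. The lateral condition removes the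
boundary term at `c`. Far to the right the barrier has no flux, so only the flux of `u` remains, and
its limit is nonpositive because `u^m` is bounded. -/
theorem IsStrongSolutionOn.supersolution_comparison {m p b β : ℝ} {T : EReal} {a : ℝ}
    {u₀ : ℝ → ℝ} {u : ℝ → ℝ → ℝ} (H : IsStrongSolutionOn m p b β T (Ioi a) u₀ u) (hm : 0 < m)
    (hp : 0 < p) (hb : 0 ≤ b) {c δ : ℝ} (hac : a < c) (hc0 : c < 0) (hδ : (δ : EReal) < T)
    {W Wt V Q : ℝ → ℝ → ℝ} (hW : IsBarrier m p W Wt V Q)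
    (hW0 : ∀ x t, 0 ≤ x → W x t = 0 ∧ Wt x t = 0 ∧ V x t = 0 ∧ Q x t = 0)
    (hsuper : ∀ x t, 0 < t → t < δ → Q x t ≤ Wt x t)
    (hmono : ∀ x t, 0 ≤ t → W x 0 ≤ W x t) (hinit : ∀ x, c < x → u₀ x ≤ W x 0)
    (hlat : ∀ t ∈ Icc 0 δ, u c t ≤ W c t) {x t : ℝ} (hx : c < x) (ht : t ∈ Icc 0 δ) :
    u x t ≤ W x t := by
  rcases ht.1.eq_or_lt with rfl | htpos
  · rw [H.initial x (hac.trans hx)]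
    exact hinit x hx
  have htT : (t : EReal) < T := (EReal.coe_le_coe_iff.mpr ht.2).trans_lt hδ
  obtain ⟨v, ut, q, S⟩ := H.exists_hasSlices hm hac
  have hsub : Ioi c ⊆ Ioi a := Ioi_subset_Ioi hac.le
  have HJ := H.mono hsub
  have hcomp : ∀ {f : ℝ → ℝ}, Continuous f → (∀ x, 0 ≤ x → f x = 0) → IntegrableOn f (Ioi c) := by
    intro f hf hf0
    refine (hf.integrableOn_Icc (a := c) (b := 0)).of_forall_sdiff_eq_zero measurableSet_Ioi
      fun x hx => hf0 x ?_
    by_contra! h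
    exact hx.2 ⟨le_of_lt hx.1, h.le⟩
  have hposi : ∀ s ∈ timeIco T, IntegrableOn (fun x => max (u x s - W x s) 0) (Ioi c) :=
    fun s hs => ((HJ.integrableOn s hs).sub
      (hcomp (hW.continuous_space s) fun x hx => (hW0 x s hx).1)).pos_part
  suffices h : ∀ x ∈ Ioi c, u x t - W x t ≤ 0 by linarith [h x hx]
  have htime : ∀ s, 0 < s → s ≤ t → s ∈ timeIco T := fun s hs hst =>
    Icc_subset_timeIco hs.le htT ⟨le_rfl, hst⟩
  refine HJ.nonpos_of_mass_le isOpen_Ioi htpos htT (G := fun x t => u x t - W x t)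
    ((HJ.continuousOn_space (htime t htpos le_rfl)).sub (hW.continuous_space t).continuousOn)
    (hposi t (htime t htpos le_rfl)) (fun s hs hst => ?_) (fun s hs hst x hx => ?_)
  swap
  -- Since `u₀ ≤ W(·, 0) ≤ W(·, s)`, the excess at time `s` is at most `u(·, s) - u₀`.
  · refine max_le ?_ (abs_nonneg _)
    rw [HJ.initial x hx]
    have h1 := hinit x hx
    have h2 := hmono x s hs.le
    exact le_trans (by linarith) (le_abs_self _)
  have hWti : IntegrableOn (fun z : ℝ × ℝ => Wt z.1 z.2) (Ioi c ×ˢ Icc s t) := by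
    have h1 : IntegrableOn (fun z : ℝ × ℝ => Wt z.1 z.2) (Icc c 0 ×ˢ Icc s t) :=
      hW.continuous_time_deriv.continuousOn.integrableOn_compact (isCompact_Icc.prod isCompact_Icc)
    refine h1.of_forall_sdiff_eq_zero (measurableSet_Ioi.prod measurableSet_Icc)
      fun z hz => (hW0 z.1 z.2 ?_).2.1
    by_contra! h
    exact hz.2 ⟨⟨le_of_lt hz.1.1, h.le⟩, hz.1.2⟩
  have hGt : IntegrableOn (fun z : ℝ × ℝ => ut z.1 z.2 - Wt z.1 z.2) (Ioi c ×ˢ Icc s t) :=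
    (S.integrable_ut s t hs hst htT).sub hWti
  have hsubT : Ioo s t ⊆ timeIoo T := Ioo_subset_Icc_self.trans (Icc_subset_timeIoo hs htT)
  refine integral_max_zero_le measurableSet_Ioi (G := fun x t => u x t - W x t)
    (Gt := fun x t => ut x t - Wt x t) hst ?_ ?_ hGt
    (hposi s (htime s hs hst)) (hposi t (htime t htpos le_rfl)) ?_
  · rw [ae_restrict_iff' measurableSet_Ioi]
    filter_upwards [S.time] with x hx hx'
    exact (hx hx' s t hs hst htT).sub (hW.hasACDeriv_time x s t)
  · exact (HJ.continuousOn.mono (prod_mono le_rfl (Icc_subset_timeIco hs.le htT))).sub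
      hW.continuous.continuousOn
  have hr := Measure.restrict_mono hsubT (le_refl (volume : Measure ℝ))
  filter_upwards [ae_mono hr S.pressure, ae_mono hr S.flux, ae_mono hr S.equation,
    ae_prod_slice_integrable (f := fun x t => ut x t - Wt x t) hGt,
    ae_prod_slice_integrable (S.integrable_q s t hs hst htT),
    ae_restrict_mem measurableSet_Ioo] with τ e1 ⟨F, e2, e2'⟩ e3 e4 e5 hτ
  have hτT : τ ∈ timeIco T := htime τ (hs.trans hτ.1) hτ.2.le
  have hQi := hcomp (hW.continuous_flux_deriv τ) fun x hx => (hW0 x τ hx).2.2.2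
  have hcont : ContinuousOn (fun x => u x τ - W x τ) (Ioi c) :=
    (HJ.continuousOn_space hτT).sub (hW.continuous_space τ).continuousOn
  have hqQi := integrableOn_indicator_pos isOpen_Ioi hcont (e5.sub hQi)
  have step : ∫ x in Ioi c, {x | 0 < u x τ - W x τ}.indicator (fun x => ut x τ - Wt x τ) x ≤
      ∫ x in Ioi c, {x | 0 < u x τ - W x τ}.indicator ((fun x => q x τ) - fun x => Q x τ) x := by
    refine integral_mono_ae (integrableOn_indicator_pos isOpen_Ioi hcont e4) hqQi ?_
    rw [EventuallyLE, ae_restrict_iff' measurableSet_Ioi]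
    filter_upwards [e3] with x hx hxc
    refine indicator_le_indicator ?_
    have h1 := hx hxc
    have h2 := hsuper x τ (hs.trans hτ.1) (hτ.2.trans_le ht.2)
    have h3 : 0 ≤ b * u x τ ^ β := mul_nonneg hb (Real.rpow_nonneg (HJ.nonneg x hxc τ hτT) _)
    simp only [Pi.sub_apply]
    linarith
  refine step.trans ?_
  -- The flux has a limit because its derivative `q` is integrable on the half-line.
  have hFlim : Tendsto F atTop (𝓝 (F c + ∫ x in Ioi c, q x τ)) := by
    have h1 := intervalIntegral_tendsto_integral_Ioi c e5 tendsto_id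
    refine (h1.const_add (F c)).congr' ?_
    filter_upwards [eventually_ge_atTop c] with R hR
    rw [id, (e2 R hR).integral_eq_sub hR]
    ring
  have hL := flux_limit_nonpos hp e1 e2' hFlim
    (fun x hx => Real.rpow_nonneg (HJ.nonneg x hx τ hτT) m) (B := ?_) ?_
  rotate_left
  · exact (H.bounded τ (hs.trans hτ.1)).choose ^ m
  · intro x hx
    exact Real.rpow_le_rpow (HJ.nonneg x hx τ hτT)
      ((H.bounded τ (hs.trans hτ.1)).choose_spec x (hsub hx) τ hτT le_rfl) hm.le
  have hlim := intervalIntegral_tendsto_integral_Ioi c hqQi tendsto_id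
  have hmax : Tendsto (fun R => max (F R) 0) atTop (𝓝 0) := by
    have := hFlim.max (tendsto_const_nhds (x := (0 : ℝ)))
    rwa [max_eq_right hL] at this
  refine le_of_tendsto_of_tendsto hlim hmax ?_
  filter_upwards [eventually_ge_atTop 0] with R hR
  have hcR : c ≤ R := hc0.le.trans hR
  have key := integral_indicator_deriv_le hcR ((e2 R hcR).sub (hW.hasACDeriv_flux τ c R))
    ((e1 R hcR).sub (hW.hasACDeriv_pressure τ c R)) (B := max (F R) 0) ?_ ?_ (le_max_right _ _) ?_
  · refine le_trans (le_of_eq ?_) key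
    refine intervalIntegral.integral_congr_ae (.of_forall fun x hx => ?_)
    rw [id, uIoc_of_le hcR] at hx
    have hiff := rpow_sub_rpow_pos_iff hm (HJ.nonneg x hx.1 τ hτT) (hW.nonneg x τ)
    simp only [indicator, mem_ofPred_eq, hiff, Pi.sub_apply]
  · filter_upwards [e2'] with x hx hx'
    rw [← hx hx'.1]
    exact signedPow_sub_mul_sub_nonneg hp _ _
  · have h1 := hlat τ ⟨(hs.trans hτ.1).le, hτ.2.le.trans ht.2⟩
    have h2 := Real.rpow_le_rpow (H.nonneg c hac τ hτT) h1 hm.le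
    linarith
  · right
    rw [(hW0 R τ hR).2.2.1, signedPow_zero, sub_zero]
    exact le_max_left _ _

/-- The barrier vanishes at both endpoints, so `u ≥ 0` is all the boundary information needed. Where
`W > u`, one has `u^β ≤ W^β ≤ K W`, which replaces the absorption of `u` by a linear term in `W`. -/
theorem IsStrongSolutionOn.subsolution_comparison {m p b β : ℝ} {T : EReal} {a : ℝ}
    {u₀ : ℝ → ℝ} {u : ℝ → ℝ → ℝ} (H : IsStrongSolutionOn m p b β T (Ioi a) u₀ u) (hm : 0 < m)
    (hp : 0 < p) (hb : 0 ≤ b) (hβ : 0 ≤ β) {c d K : ℝ} (hac : a < c) (hcd : c ≤ d)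
    {W Wt V Q : ℝ → ℝ → ℝ} (hW : IsBarrier m p W Wt V Q)
    (hWc : ∀ t, W c t = 0) (hWd : ∀ t, W d t = 0)
    (hK : ∀ x t, 0 < t → W x t ^ β ≤ K * W x t)
    (hsub : ∀ x t, 0 < t → x ∈ Ioo c d → Wt x t ≤ Q x t - b * (K * W x t))
    (hmono : ∀ x t, 0 ≤ t → W x t ≤ W x 0) (hinit : ∀ x ∈ Ioo c d, W x 0 ≤ u₀ x)
    {x t : ℝ} (hx : x ∈ Ioo c d) (ht : t ∈ timeIco T) :
    W x t ≤ u x t := by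
  have hJa : Icc c d ⊆ Ioi a := fun x hx => hac.trans_le hx.1
  have hJa' : Ioo c d ⊆ Ioi a := Ioo_subset_Icc_self.trans hJa
  rcases ht.1.eq_or_lt with rfl | htpos
  · rw [H.initial x (hJa' hx)]
    exact hinit x hx
  have htT := ht.2
  obtain ⟨v, ut, q, S⟩ := H.exists_hasSlices hm hac
  have hJc : Ioo c d ⊆ Ioi c := fun x hx => hx.1
  have HJ := H.mono hJa'
  have hcomp : ∀ {f : ℝ → ℝ}, Continuous f → IntegrableOn f (Ioo c d) := fun hf =>
    hf.integrableOn_Icc.mono_set Ioo_subset_Icc_self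
  have hposi : ∀ s ∈ timeIco T, IntegrableOn (fun x => max (W x s - u x s) 0) (Ioo c d) :=
    fun s hs => ((hcomp (hW.continuous_space s)).sub (HJ.integrableOn s hs)).pos_part
  suffices h : ∀ x ∈ Ioo c d, W x t - u x t ≤ 0 by linarith [h x hx]
  have htime : ∀ s, 0 < s → s ≤ t → s ∈ timeIco T := fun s hs hst =>
    Icc_subset_timeIco hs.le htT ⟨le_rfl, hst⟩
  refine HJ.nonpos_of_mass_le isOpen_Ioo htpos htT (G := fun x t => W x t - u x t)
    ((hW.continuous_space t).continuousOn.sub (HJ.continuousOn_space ht))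
    (hposi t ht) (fun s hs hst => ?_) (fun s hs hst x hx => ?_)
  swap
  · refine max_le ?_ (abs_nonneg _)
    rw [HJ.initial x hx]
    have h1 := hinit x hx
    have h2 := hmono x s hs.le
    exact le_trans (by linarith) (neg_le_abs _)
  have hWti : IntegrableOn (fun z : ℝ × ℝ => Wt z.1 z.2) (Ioo c d ×ˢ Icc s t) :=
    (hW.continuous_time_deriv.continuousOn.integrableOn_compact
      (isCompact_Icc.prod isCompact_Icc)).mono_set (prod_mono Ioo_subset_Icc_self le_rfl)
  have hGt : IntegrableOn (fun z : ℝ × ℝ => Wt z.1 z.2 - ut z.1 z.2) (Ioo c d ×ˢ Icc s t) :=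
    hWti.sub ((S.integrable_ut s t hs hst htT).mono_set (prod_mono hJc le_rfl))
  have hsubT : Ioo s t ⊆ timeIoo T := Ioo_subset_Icc_self.trans (Icc_subset_timeIoo hs htT)
  refine integral_max_zero_le measurableSet_Ioo (G := fun x t => W x t - u x t)
    (Gt := fun x t => Wt x t - ut x t) hst ?_ ?_ hGt
    (hposi s (htime s hs hst)) (hposi t ht) ?_
  · rw [ae_restrict_iff' measurableSet_Ioo]
    filter_upwards [S.time] with x hx hx'
    exact (hW.hasACDeriv_time x s t).sub (hx hx'.1 s t hs hst htT)
  · exact hW.continuous.continuousOn.sub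
      (HJ.continuousOn.mono (prod_mono le_rfl (Icc_subset_timeIco hs.le htT)))
  have hr := Measure.restrict_mono hsubT (le_refl (volume : Measure ℝ))
  filter_upwards [ae_mono hr S.pressure, ae_mono hr S.flux, ae_mono hr S.equation,
    ae_prod_slice_integrable (f := fun x t => Wt x t - ut x t) hGt,
    ae_prod_slice_integrable (S.integrable_q s t hs hst htT),
    ae_restrict_mem measurableSet_Ioo] with τ e1 ⟨F, e2, e2'⟩ e3 e4 e5 hτ
  have hτ0 : 0 < τ := hs.trans hτ.1
  have hτT : τ ∈ timeIco T := htime τ hτ0 hτ.2.le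
  have hcont : ContinuousOn (fun x => W x τ - u x τ) (Ioo c d) :=
    (hW.continuous_space τ).continuousOn.sub (HJ.continuousOn_space hτT)
  have hqQi := integrableOn_indicator_pos isOpen_Ioo hcont
    ((hcomp (hW.continuous_flux_deriv τ)).sub (e5.mono_set hJc))
  have step : ∫ x in Ioo c d, {x | 0 < W x τ - u x τ}.indicator (fun x => Wt x τ - ut x τ) x ≤
      ∫ x in Ioo c d, {x | 0 < W x τ - u x τ}.indicator ((fun x => Q x τ) - fun x => q x τ) x := by
    refine integral_mono_ae (integrableOn_indicator_pos isOpen_Ioo hcont e4) hqQi ?_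
    rw [EventuallyLE, ae_restrict_iff' measurableSet_Ioo]
    filter_upwards [e3] with x hx hxJ
    by_cases hpos : 0 < W x τ - u x τ
    · rw [indicator_of_mem (by simpa using hpos), indicator_of_mem (by simpa using hpos)]
      have h1 := hx hxJ.1
      have h2 := hsub x τ hτ0 hxJ
      have h3 := Real.rpow_le_rpow (HJ.nonneg x hxJ τ hτT) (sub_pos.mp hpos).le hβ
      have h4 := mul_le_mul_of_nonneg_left (h3.trans (hK x τ hτ0)) hb
      simp only [Pi.sub_apply]
      linarith
    · rw [indicator_of_notMem (by simpa using hpos), indicator_of_notMem (by simpa using hpos)]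
  refine step.trans ?_
  have key := integral_indicator_deriv_le hcd ((hW.hasACDeriv_flux τ c d).sub (e2 d hcd))
    ((hW.hasACDeriv_pressure τ c d).sub (e1 d hcd)) ?_ ?_ le_rfl (.inl ?_)
  · refine le_trans (le_of_eq ?_) key
    rw [intervalIntegral.integral_of_le hcd, integral_Ioc_eq_integral_Ioo]
    refine setIntegral_congr_fun measurableSet_Ioo fun x hx => ?_
    have hiff := rpow_sub_rpow_pos_iff hm (hW.nonneg x τ) (HJ.nonneg x hx τ hτT)
    simp only [indicator, mem_ofPred_eq, hiff, Pi.sub_apply]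
  · filter_upwards [e2'] with x hx hx'
    rw [← hx hx'.1]
    exact signedPow_sub_mul_sub_nonneg hp _ _
  · rw [hWc, Real.zero_rpow hm.ne', zero_sub, neg_nonpos]
    exact Real.rpow_nonneg (H.nonneg c hac τ hτT) m
  · rw [hWd, Real.zero_rpow hm.ne', zero_sub, neg_nonpos]
    exact Real.rpow_nonneg (H.nonneg d (hac.trans_le hcd) τ hτT) m

/-! ### Explicit profiles -/

/-- A nonnegative function `h` of space with `V = (h^m)'` and `Q = (|V|^(p-1) V)'`. -/
structure IsProfile (m p : ℝ) (h V Q : ℝ → ℝ) : Prop where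
  nonneg : ∀ x, 0 ≤ h x
  continuous : Continuous h
  hasDerivAt_pressure : ∀ x, HasDerivAt (fun x => h x ^ m) (V x) x
  continuous_pressure_deriv : Continuous V
  hasDerivAt_flux : ∀ x, HasDerivAt (fun x => signedPow p (V x)) (Q x) x
  continuous_flux_deriv : Continuous Q

/-- The diffusion operator is homogeneous of degree `mp`, so a factor `e^{κt}` leaves it as
`e^{κtmp}`. -/
theorem IsProfile.isBarrier {m p : ℝ} {h V Q : ℝ → ℝ} (H : IsProfile m p h V Q) (hp : 0 < p)
    (κ : ℝ) :
    IsBarrier m p (fun x t => Real.exp (κ * t) * h x) (fun x t => κ * Real.exp (κ * t) * h x)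
      (fun x t => Real.exp (κ * t * m) * V x) (fun x t => Real.exp (κ * t * m * p) * Q x) where
  nonneg x t := mul_nonneg (Real.exp_pos _).le (H.nonneg x)
  continuous := by
    have := H.continuous
    fun_prop
  continuous_time_deriv := by
    have := H.continuous
    fun_prop
  hasDerivAt_time x t := by
    have h1 := ((((hasDerivAt_id t).const_mul κ).exp).mul_const (h x))
    refine h1.congr_deriv ?_
    simp only [id]
    ring
  hasDerivAt_pressure x t := by
    refine ((H.hasDerivAt_pressure x).const_mul (Real.exp (κ * t * m))).congr_of_eventuallyEq
      (.of_forall fun y => ?_)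
    dsimp only
    rw [Real.mul_rpow (Real.exp_pos _).le (H.nonneg y), ← Real.exp_mul]
  continuous_pressure_deriv t := H.continuous_pressure_deriv.const_mul _
  hasDerivAt_flux x t := by
    refine ((H.hasDerivAt_flux x).const_mul (Real.exp (κ * t * m * p))).congr_of_eventuallyEq
      (.of_forall fun y => ?_)
    dsimp only
    rw [signedPow_mul hp (Real.exp_pos _).le, ← Real.exp_mul]
  continuous_flux_deriv t := H.continuous_flux_deriv.const_mul _

theorem hasDerivAt_max_zero_rpow {s : ℝ} (hs : 1 < s) (y : ℝ) :
    HasDerivAt (fun y : ℝ => max y 0 ^ s) (s * max y 0 ^ (s - 1)) y := by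
  rcases lt_trichotomy y 0 with h | rfl | h
  · rw [max_eq_right h.le, Real.zero_rpow (by linarith), mul_zero]
    refine (hasDerivAt_const y (0 : ℝ)).congr_of_eventuallyEq ?_
    filter_upwards [eventually_lt_nhds h] with z hz
    rw [max_eq_right hz.le, Real.zero_rpow (by linarith)]
  · rw [max_self, Real.zero_rpow (by linarith), mul_zero]
    have h1 := hasDerivAt_abs_rpow 0 hs
    rw [mul_zero] at h1
    rw [hasDerivAt_iff_isLittleO_nhds_zero] at h1 ⊢
    simp only [zero_add, max_self, abs_zero, smul_zero, sub_zero,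
      Real.zero_rpow (show s ≠ 0 by linarith)] at h1 ⊢
    refine (Asymptotics.IsBigO.of_bound 1 (.of_forall fun h => ?_)).trans_isLittleO h1
    rw [one_mul, Real.norm_of_nonneg (Real.rpow_nonneg (le_max_right _ _) _),
      Real.norm_of_nonneg (Real.rpow_nonneg (abs_nonneg _) _)]
    exact Real.rpow_le_rpow (le_max_right _ _) (max_le (le_abs_self _) (abs_nonneg _))
      (by linarith)
  · rw [max_eq_left h.le]
    refine (Real.hasDerivAt_rpow_const (.inl h.ne')).congr_of_eventuallyEq ?_
    filter_upwards [eventually_gt_nhds h] with z hz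
    rw [max_eq_left hz.le]

theorem continuous_max_zero_rpow {s : ℝ} (hs : 0 ≤ s) :
    Continuous fun y : ℝ => max y 0 ^ s :=
  (continuous_id.max continuous_const).rpow_const fun _ => .inr hs

theorem continuous_signedPow {p : ℝ} (hp : 0 < p) : Continuous (signedPow p) :=
  (signedPow_monotone hp).continuous_of_surjective fun v => ⟨_, signedPow_signedPow_inv hp v⟩

theorem max_zero_rpow_rpow (y s r : ℝ) : (max y 0 ^ s) ^ r = max y 0 ^ (s * r) :=
  (Real.rpow_mul (le_max_right _ _) _ _).symm

/-- The power profile `A (-x)_+^γ`, `γ = (1 + p) / (m p - 1)`, at the critical waiting-time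
exponent: diffusion acts on it as multiplication by a constant. -/
theorem exists_waitingTime_profile {m p : ℝ} (hm : 0 < m) (hp : 0 < p) (hmp : 1 < m * p) {A : ℝ}
    (hA : 0 < A) :
    ∃ V Q : ℝ → ℝ, ∃ K : ℝ, 0 < K ∧
      IsProfile m p (fun x => A * max (-x) 0 ^ ((1 + p) / (m * p - 1))) V Q ∧
      (∀ x, Q x = K * (A * max (-x) 0 ^ ((1 + p) / (m * p - 1)))) ∧
      ∀ x, 0 ≤ x → V x = 0 := by
  set γ := (1 + p) / (m * p - 1) with hγ
  have hγpos : 0 < γ := div_pos (by linarith) (by linarith)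
  have hγeq : γ * (m * p - 1) = 1 + p := div_mul_cancel₀ _ (by linarith)
  -- The critical exponent identity: the flux is a multiple of `(-x)_+^(γ+1)`, so its derivative
  -- returns to the power `γ`.
  have hexp : (γ * m - 1) * p = γ + 1 := by linarith
  have hγm : 1 < γ * m := by
    by_contra! h
    have : (γ * m - 1) * p ≤ 0 := mul_nonpos_of_nonpos_of_nonneg (by linarith) hp.le
    linarith
  have hAm : 0 < A ^ m := Real.rpow_pos_of_pos hA m
  have hB : 0 < A ^ m * (γ * m) := by positivity
  refine ⟨fun x => -(A ^ m * (γ * m) * max (-x) 0 ^ (γ * m - 1)),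
    fun x => (A ^ m * (γ * m)) ^ p * (γ + 1) / A * (A * max (-x) 0 ^ γ),
    (A ^ m * (γ * m)) ^ p * (γ + 1) / A, by positivity, ⟨?_, ?_, ?_, ?_, ?_, ?_⟩,
    fun x => rfl, ?_⟩
  · exact fun x => mul_nonneg hA.le (Real.rpow_nonneg (le_max_right _ _) _)
  · exact ((continuous_max_zero_rpow hγpos.le).comp continuous_neg).const_mul A
  · intro x
    have h1 := ((hasDerivAt_max_zero_rpow hγm (-x)).comp x (hasDerivAt_neg x)).const_mul (A ^ m)
    refine (h1.congr_deriv (by ring)).congr_of_eventuallyEq (.of_forall fun y => ?_)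
    dsimp only [Function.comp]
    rw [Real.mul_rpow hA.le (Real.rpow_nonneg (le_max_right _ _) _), max_zero_rpow_rpow]
  · exact (((continuous_max_zero_rpow (by linarith)).comp continuous_neg).const_mul _).neg
  · intro x
    have h1 := ((hasDerivAt_max_zero_rpow (s := γ + 1) (by linarith) (-x)).comp x
      (hasDerivAt_neg x)).const_mul (-(A ^ m * (γ * m)) ^ p)
    refine (h1.congr_deriv ?_).congr_of_eventuallyEq (.of_forall fun y => ?_)
    · rw [add_sub_cancel_right]
      field_simp
    · dsimp only [Function.comp]
      rw [signedPow_neg, signedPow_mul hp hB.le,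
        signedPow_of_nonneg hp (Real.rpow_nonneg (le_max_right _ _) _), max_zero_rpow_rpow, hexp]
      ring
  · exact (((continuous_max_zero_rpow hγpos.le).comp continuous_neg).const_mul A).const_mul _
  · intro x hx
    dsimp only
    rw [max_eq_right (by linarith), Real.zero_rpow (by linarith), mul_zero, neg_zero]

/-- A compactly supported profile on `[x₀ - r, x₀ + r]` whose diffusion is bounded below by a
multiple of itself. -/
theorem exists_bump_profile {m p : ℝ} (hm : 0 < m) (hp : 0 < p) (hmp : 1 < m * p) {A r : ℝ}
    (hA : 0 < A) (hr : 0 < r) (x₀ : ℝ) :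
    ∃ h V Q : ℝ → ℝ, ∃ K : ℝ, 0 ≤ K ∧ IsProfile m p h V Q ∧ (∀ x, h x ≤ A) ∧ 0 < h x₀ ∧
      h (x₀ - r) = 0 ∧ h (x₀ + r) = 0 ∧ ∀ x, -(K * h x) ≤ Q x := by
  -- `(k-1)p > 1` makes the flux `C¹`, and `k/m ≤ (k-1)p` lets the profile dominate the negative
  -- part of its diffusion. The summand `mp/(mp-1)` alone gives equality in the latter; adding `1 +
  -- 1/p` secures the former.
  obtain ⟨k, hk1, hk2⟩ : ∃ k : ℝ, 1 < (k - 1) * p ∧ k / m ≤ (k - 1) * p := by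
    have hmp' : 0 < m * p - 1 := by linarith
    refine ⟨m * p / (m * p - 1) + (1 + 1 / p), ?_, ?_⟩
    · have : 0 < m * p / (m * p - 1) * p := by positivity
      have h2 : (m * p / (m * p - 1) + (1 + 1 / p) - 1) * p = m * p / (m * p - 1) * p + 1 := by
        field_simp
        ring
      linarith
    · rw [div_le_iff₀ hm, ← sub_nonneg]
      have h2 : (m * p / (m * p - 1) + (1 + 1 / p) - 1) * p * m
          - (m * p / (m * p - 1) + (1 + 1 / p)) = (1 + 1 / p) * (m * p - 1) := by
        field_simp
        ring
      rw [h2]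
      positivity
  have hk : 1 < k := by
    by_contra! h
    have : (k - 1) * p ≤ 0 := mul_nonpos_of_nonpos_of_nonneg (by linarith) hp.le
    linarith
  have hkm : 0 < k / m := by positivity
  have hp1 : 0 < 1 / p := by positivity
  have hAm : 0 < A ^ m := Real.rpow_pos_of_pos hA m
  -- With this exponent the derivative of `|y|^e` is a multiple of the odd `1/p`-th power of `y`,
  -- which the odd `p`-th power turns back into `y`: the flux is `-c₁^p s_+^((k-1)p) y`.
  set e : ℝ := 1 + 1 / p with he
  set c₁ : ℝ := A ^ m * k * e / r with hc₁
  have hc₁pos : 0 < c₁ := by positivity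
  let y : ℝ → ℝ := fun x => (x - x₀) / r
  let s : ℝ → ℝ := fun x => 1 - |y x| ^ e
  have hy : ∀ x, HasDerivAt y (1 / r) x := fun x => ((hasDerivAt_id x).sub_const x₀).div_const r
  have hyc : Continuous y := (continuous_id.sub continuous_const).div_const r
  have hs : ∀ x, HasDerivAt s (-(e * signedPow (1 / p) (y x) / r)) x := by
    intro x
    have h1 := ((hasDerivAt_abs_rpow (y x) (p := e) (by linarith)).comp x (hy x)).const_sub 1
    refine h1.congr_deriv ?_
    rw [signedPow, show e - 2 = 1 / p - 1 by rw [he]; ring]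
    ring
  have hsc : Continuous s := continuous_const.sub (hyc.abs.rpow_const fun _ => .inr (by linarith))
  have hs1 : ∀ x, max (s x) 0 ≤ 1 := fun x => max_le
    (sub_le_self _ (Real.rpow_nonneg (abs_nonneg _) _)) zero_le_one
  have hs0 : ∀ x, 0 ≤ max (s x) 0 := fun x => le_max_right _ _
  have hsp : Continuous fun x => signedPow (1 / p) (y x) := (continuous_signedPow hp1).comp hyc
  refine ⟨fun x => A * max (s x) 0 ^ (k / m),
    fun x => -(c₁ * (max (s x) 0 ^ (k - 1) * signedPow (1 / p) (y x))),
    fun x => -(c₁ ^ p * (max (s x) 0 ^ ((k - 1) * p) / r)) + c₁ ^ p * ((k - 1) * p *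
      max (s x) 0 ^ ((k - 1) * p - 1) * (e * (signedPow (1 / p) (y x) * y x) / r)),
    c₁ ^ p / (r * A), by positivity, ⟨?_, ?_, ?_, ?_, ?_, ?_⟩, ?_, ?_, ?_, ?_, ?_⟩
  · exact fun x => mul_nonneg hA.le (Real.rpow_nonneg (hs0 x) _)
  · exact ((continuous_max_zero_rpow hkm.le).comp hsc).const_mul A
  · intro x
    have h1 := ((hasDerivAt_max_zero_rpow hk (s x)).comp x (hs x)).const_mul (A ^ m)
    refine (h1.congr_deriv (by rw [hc₁]; ring)).congr_of_eventuallyEq (.of_forall fun z => ?_)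
    dsimp only [Function.comp]
    rw [Real.mul_rpow hA.le (Real.rpow_nonneg (hs0 z) _), max_zero_rpow_rpow,
      div_mul_cancel₀ _ hm.ne']
  · exact ((((continuous_max_zero_rpow (by linarith)).comp hsc).mul hsp).const_mul _).neg
  · intro x
    have h1 := (((hasDerivAt_max_zero_rpow hk1 (s x)).comp x (hs x)).mul (hy x)).const_mul
      (-c₁ ^ p)
    refine (h1.congr_deriv ?_).congr_of_eventuallyEq (.of_forall fun z => ?_)
    · dsimp only [Function.comp]
      ring
    · dsimp only [Function.comp, Pi.mul_apply]
      rw [signedPow_neg, signedPow_mul hp hc₁pos.le,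
        signedPow_mul hp (Real.rpow_nonneg (hs0 z) _), signedPow_signedPow_inv hp,
        max_zero_rpow_rpow]
      ring
  · refine Continuous.add ?_ ?_
    · exact ((((continuous_max_zero_rpow (by linarith)).comp hsc).div_const r).const_mul _).neg
    · exact ((((continuous_max_zero_rpow (by linarith)).comp hsc).const_mul _).mul
        (((hsp.mul hyc).const_mul e).div_const r)).const_mul _
  · intro x
    calc A * max (s x) 0 ^ (k / m) ≤ A * 1 := mul_le_mul_of_nonneg_left
          (Real.rpow_le_one (hs0 x) (hs1 x) hkm.le) hA.le
      _ = A := mul_one A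
  · simp only [s, y, sub_self, zero_div, abs_zero, Real.zero_rpow (show e ≠ 0 by positivity),
      sub_zero, max_eq_left zero_le_one, Real.one_rpow, mul_one]
    exact hA
  · simp [s, y, hr.ne', hkm.ne']
  · simp [s, y, hr.ne', hkm.ne']
  · intro x
    -- Of the two terms of `Q`, the one from differentiating `s` is nonnegative and is dropped; the
    -- other is compared with the profile using `0 ≤ s_+ ≤ 1`.
    have h1 : max (s x) 0 ^ ((k - 1) * p) ≤ max (s x) 0 ^ (k / m) :=
      Real.rpow_le_rpow_of_exponent_ge' (hs0 x) (hs1 x) hkm.le hk2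
    have h2 : 0 ≤ signedPow (1 / p) (y x) * y x := by
      rw [signedPow, mul_assoc]
      exact mul_nonneg (Real.rpow_nonneg (abs_nonneg _) _) (mul_self_nonneg _)
    have h3 : 0 ≤ c₁ ^ p * ((k - 1) * p * max (s x) 0 ^ ((k - 1) * p - 1) *
        (e * (signedPow (1 / p) (y x) * y x) / r)) := by
      have := Real.rpow_nonneg (hs0 x) ((k - 1) * p - 1)
      have : 0 ≤ k - 1 := by linarith
      positivity
    have h4 : c₁ ^ p / (r * A) * (A * max (s x) 0 ^ (k / m)) =
        c₁ ^ p * (max (s x) 0 ^ (k / m) / r) := by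
      field_simp
    have h5 : c₁ ^ p * (max (s x) 0 ^ ((k - 1) * p) / r) ≤
        c₁ ^ p * (max (s x) 0 ^ (k / m) / r) := by gcongr
    dsimp only
    linarith

/-! ### The two bounds on the interface -/

/-- Positivity persists when the absorption is at most linear near zero. -/
theorem IsSolution.pos_of_initial_pos {m p b β : ℝ} (hm : 0 < m) (hp : 0 < p) (hb : 0 ≤ b)
    (hmp : 1 < m * p) (hβ : 1 ≤ β) {T : EReal} {u₀ : ℝ → ℝ} (hu₀ : Continuous u₀)
    {u : ℝ → ℝ → ℝ} (hu : IsSolution m p b β T u₀ u) {x₀ : ℝ} (hx₀ : 0 < u₀ x₀) {t : ℝ}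
    (ht : t ∈ timeIco T) : 0 < u x₀ t := by
  set A := u₀ x₀ / 2 with hAdef
  have hA : 0 < A := half_pos hx₀
  obtain ⟨r, hr, hball⟩ := Metric.eventually_nhds_iff_ball.mp
    (hu₀.continuousAt.eventually_const_lt (half_lt_self hx₀))
  obtain ⟨h, V, Q, K, hK, hP, hhA, hh0, hhl, hhr, hQ⟩ := exists_bump_profile hm hp hmp hA hr x₀
  -- The decay rate pays for the diffusive loss `K` and for the absorption, whose linear rate is at
  -- most `b A^(β-1)` on values up to `A`.
  set κ := -(K + b * A ^ (β - 1)) with hκ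
  have hκ0 : κ ≤ 0 := by
    have := mul_nonneg hb (Real.rpow_nonneg hA.le (β - 1))
    linarith
  have hexp1 : ∀ t, 0 ≤ t → Real.exp (κ * t) ≤ 1 := fun t ht =>
    Real.exp_le_one_iff.mpr (mul_nonpos_of_nonpos_of_nonneg hκ0 ht)
  have hcmp := (hu (x₀ - r - 1)).subsolution_comparison hm hp hb (by linarith)
    (c := x₀ - r) (d := x₀ + r) (K := A ^ (β - 1)) (by linarith) (by linarith)
    (hP.isBarrier hp κ) (fun t => by rw [hhl, mul_zero]) (fun t => by rw [hhr, mul_zero])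
    ?_ ?_ ?_ ?_ (x := x₀) (t := t) ⟨by linarith, by linarith⟩ ht
  · exact (mul_pos (Real.exp_pos _) hh0).trans_le hcmp
  · intro x t ht
    have hW0 : 0 ≤ Real.exp (κ * t) * h x := mul_nonneg (Real.exp_pos _).le (hP.nonneg x)
    have hWA : Real.exp (κ * t) * h x ≤ A :=
      (mul_le_of_le_one_left (hP.nonneg x) (hexp1 t ht.le)).trans (hhA x)
    calc (Real.exp (κ * t) * h x) ^ β
        = (Real.exp (κ * t) * h x) ^ (β - 1) * (Real.exp (κ * t) * h x) := by
          rw [← Real.rpow_add_one' hW0 (by linarith), sub_add_cancel]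
      _ ≤ A ^ (β - 1) * (Real.exp (κ * t) * h x) :=
          mul_le_mul_of_nonneg_right (Real.rpow_le_rpow hW0 hWA (by linarith)) hW0
  · intro x t ht _
    -- As `mp > 1` and `κt ≤ 0`, the diffusion of the decaying bump fades at least as fast as the
    -- bump itself.
    have h1 : Real.exp (κ * t * m * p) ≤ Real.exp (κ * t) := by
      refine Real.exp_le_exp.mpr ?_
      have : κ * t ≤ 0 := mul_nonpos_of_nonpos_of_nonneg hκ0 ht.le
      nlinarith
    have h2 := mul_le_mul_of_nonneg_left (hQ x) (Real.exp_pos (κ * t * m * p)).le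
    have h3 := mul_le_mul_of_nonneg_right h1 (mul_nonneg hK (hP.nonneg x))
    have h4 : κ * Real.exp (κ * t) * h x =
        -(Real.exp (κ * t) * (K * h x)) - b * (A ^ (β - 1) * (Real.exp (κ * t) * h x)) := by
      rw [hκ]; ring
    linarith
  · intro x t ht
    rw [mul_zero, Real.exp_zero, one_mul]
    exact mul_le_of_le_one_left (hP.nonneg x) (hexp1 t ht)
  · intro x hx
    rw [mul_zero, Real.exp_zero, one_mul]
    refine (hhA x).trans (hball x ?_).le
    rw [Real.ball_eq_Ioo]
    exact hx

/-- Initial data below the critical power at the origin produce a waiting time. -/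
theorem IsSolution.exists_waitingTime {m p b β : ℝ} (hm : 0 < m) (hp : 0 < p) (hb : 0 ≤ b)
    (hmp : 1 < m * p) {T : EReal} (hT : 0 < T) {u₀ : ℝ → ℝ} {u : ℝ → ℝ → ℝ}
    (hu : IsSolution m p b β T u₀ u) {A c : ℝ} (hA : 0 < A) (hc : c < 0)
    (hright : ∀ x, 0 ≤ x → u₀ x ≤ 0)
    (hle : ∀ x, c < x → x < 0 → u₀ x ≤ A * (-x) ^ ((1 + p) / (m * p - 1)))
    (hlt : u₀ c < A * (-c) ^ ((1 + p) / (m * p - 1))) :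
    ∃ δ : ℝ, 0 < δ ∧ (δ : EReal) < T ∧ ∀ t ∈ Icc 0 δ, ∀ x, 0 < x → u x t ≤ 0 := by
  obtain ⟨V, Q, K, hK, hP, hQ, hV⟩ := exists_waitingTime_profile hm hp hmp hA
  set γ := (1 + p) / (m * p - 1) with hγ
  have hγpos : 0 < γ := div_pos (by linarith) (by linarith)
  -- While `κt ≤ 1`, `K e^{κtmp} ≤ K e^{mp-1} e^{κt} = κ e^{κt}`, which is the supersolution
  -- inequality.
  set κ := K * Real.exp (m * p - 1) with hκ
  have hκpos : 0 < κ := mul_pos hK (Real.exp_pos _)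
  have hz : ∀ x : ℝ, 0 ≤ x → A * max (-x) 0 ^ γ = 0 := fun x hx => by
    rw [max_eq_right (by linarith), Real.zero_rpow hγpos.ne', mul_zero]
  have hneg : ∀ x : ℝ, x < 0 → max (-x) 0 = -x := fun x hx => max_eq_left (by linarith)
  obtain ⟨δ₀, h1, h2⟩ := EReal.lt_iff_exists_real_btwn.mp hT
  have hδ₀ : 0 < δ₀ := EReal.coe_pos.mp h1
  have S := hu (c - 1)
  have hca : c ∈ Ioi (c - 1) := by simp
  have h0 : (0 : ℝ) ∈ timeIco T := Icc_subset_timeIco le_rfl h2 ⟨le_rfl, hδ₀.le⟩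
  have hev : ∀ᶠ t in 𝓝[timeIco T] (0 : ℝ), u c t < A * (-c) ^ γ := by
    have := S.continuousOn_time hca 0 h0
    refine this.eventually_lt_const ?_
    exact (S.initial c hca).trans_lt hlt
  obtain ⟨δ₁, hδ₁, hδ₁'⟩ := Metric.mem_nhdsWithin_iff.mp hev
  -- `δ₀` keeps the time below `T`, `δ₁ / 2` preserves the strict inequality at the lateral boundary
  -- `c`, and `1 / κ` ensures `κt ≤ 1`.
  set δ := min δ₀ (min (δ₁ / 2) (1 / κ)) with hδ
  have hδpos : 0 < δ := by positivity
  have hδT : (δ : EReal) < T := (EReal.coe_le_coe_iff.mpr (min_le_left _ _)).trans_lt h2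
  have hexp : ∀ t, 0 ≤ t → 1 ≤ Real.exp (κ * t) := fun t ht =>
    Real.one_le_exp (mul_nonneg hκpos.le ht)
  refine ⟨δ, hδpos, hδT, fun t ht x hx => ?_⟩
  have hcmp := S.supersolution_comparison hm hp hb (c := c) (δ := δ) hca hc hδT
    (hP.isBarrier hp κ) ?_ ?_ ?_ ?_ ?_ (hc.trans hx) ht
  · rwa [hz x hx.le, mul_zero] at hcmp
  · intro x t hx
    rw [hz x hx, hV x hx, hQ x, hz x hx]
    simp
  · intro x t ht htδ
    have h3 : κ * t ≤ 1 := by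
      have : t ≤ 1 / κ := htδ.le.trans ((min_le_right _ _).trans (min_le_right _ _))
      calc κ * t ≤ κ * (1 / κ) := mul_le_mul_of_nonneg_left this hκpos.le
        _ = 1 := mul_one_div_cancel hκpos.ne'
    have h4 : Real.exp (κ * t * m * p) ≤ Real.exp (κ * t) * Real.exp (m * p - 1) := by
      rw [← Real.exp_add]
      refine Real.exp_le_exp.mpr ?_
      nlinarith
    have h5 := mul_le_mul_of_nonneg_right h4 (mul_nonneg hK.le (hP.nonneg x))
    rw [hQ x]
    calc _ ≤ _ := h5
      _ = _ := by rw [hκ]; ring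
  · intro x t ht
    rw [mul_zero, Real.exp_zero, one_mul]
    exact le_mul_of_one_le_left (hP.nonneg x) (hexp t ht)
  · intro x hx
    rw [mul_zero, Real.exp_zero, one_mul]
    rcases lt_or_ge x 0 with h | h
    · rw [hneg x h]
      exact hle x hx h
    · rw [hz x h]
      exact hright x h
  · intro t ht
    refine le_trans ?_ (le_mul_of_one_le_left (hP.nonneg c) (hexp t ht.1))
    rw [hneg c hc]
    refine le_of_lt (hδ₁' ⟨?_, Icc_subset_timeIco le_rfl hδT ht⟩)
    have : t ≤ δ₁ / 2 := ht.2.trans ((min_le_right _ _).trans (min_le_left _ _))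
    rw [Metric.mem_ball, Real.dist_eq, sub_zero, abs_of_nonneg ht.1]
    linarith

theorem theorem4 (m p b β : ℝ) (hm : 0 < m) (hp : 0 < p) (hb : 0 < b) (hmp : 1 < m * p)
    (T : EReal) (hT : 0 < T)
    (u₀ : ℝ → ℝ) (hu₀ : Continuous u₀) (hu₀_nonneg : ∀ x, 0 ≤ u₀ x)
    (u : ℝ → ℝ → ℝ) (hu : IsSolution m p b β T u₀ u)
    (hη : interface u 0 = 0)
    (C α : ℝ) (hC : 0 < C) (hα : 0 < α)
    (h_asymp : Asymptotics.IsEquivalent (𝓝[<] (0 : ℝ)) u₀ (fun x => C * (max (-x) 0) ^ α))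
    (hα_ge : (1 + p) / (m * p - 1) ≤ α) (hβ : 1 ≤ β) :
    ∃ δ : ℝ, 0 < δ ∧ (δ : EReal) < T ∧ ∀ t ∈ Icc 0 δ, interface u t = 0 := by
  have hinit : ∀ x, u x 0 = u₀ x := fun x => (hu (x - 1)).initial x (by simp)
  have hright' : ∀ x, 0 < x → u₀ x ≤ 0 := fun x hx => by
    by_contra! h
    have h1 : (x : EReal) ≤ interface u 0 := le_sSup ⟨x, by rwa [mem_ofPred_eq, hinit], rfl⟩
    rw [hη] at h1
    exact absurd (EReal.coe_nonpos.mp h1) (not_le.mpr hx)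
  have hright : ∀ x, 0 ≤ x → u₀ x ≤ 0 := fun x hx => by
    rcases hx.eq_or_lt with rfl | hx
    · refine le_of_tendsto (hu₀.continuousAt.mono_left (nhdsWithin_le_nhds (s := Ioi 0))) ?_
      filter_upwards [self_mem_nhdsWithin] with x hx using hright' x hx
    · exact hright' x hx
  have hγpos : 0 < (1 + p) / (m * p - 1) := div_pos (by linarith) (by linarith)
  -- Asymptotic equivalence with relative error `1` gives the factor `2C`; for `-1 < x < 0` the
  -- exponent may be lowered from `α` to the critical one.
  have hev : ∀ᶠ x in 𝓝[<] (0 : ℝ), u₀ x ≤ 2 * C * (-x) ^ ((1 + p) / (m * p - 1)) := by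
    filter_upwards [h_asymp.isLittleO.def one_pos, self_mem_nhdsWithin,
      nhdsWithin_le_nhds (eventually_gt_nhds (show (-1 : ℝ) < 0 by norm_num))] with x h1 h2 h3
    have h2 : x < 0 := h2
    have h4 : 0 ≤ C * (-x) ^ α := mul_nonneg hC.le (Real.rpow_nonneg (by linarith) _)
    simp only [Pi.sub_apply, one_mul, max_eq_left (show (0 : ℝ) ≤ -x by linarith)] at h1
    rw [Real.norm_of_nonneg h4] at h1
    have h5 := (le_abs_self _).trans h1
    have h6 : (-x) ^ α ≤ (-x) ^ ((1 + p) / (m * p - 1)) :=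
      Real.rpow_le_rpow_of_exponent_ge (by linarith) (by linarith) hα_ge
    have h7 := mul_le_mul_of_nonneg_left h6 hC.le
    linarith
  obtain ⟨l, hl, hl'⟩ := mem_nhdsLT_iff_exists_Ioo_subset.mp hev
  have hl : l < 0 := hl
  -- Passing from `2C` to `3C` makes the bound strict, as the lateral boundary requires; `l / 2`
  -- lies inside the interval where the bound holds.
  have hbound : ∀ x, l / 2 ≤ x → x < 0 →
      u₀ x < 3 * C * (-x) ^ ((1 + p) / (m * p - 1)) := fun x h1 h2 => by
    have h3 : u₀ x ≤ 2 * C * (-x) ^ ((1 + p) / (m * p - 1)) := hl' ⟨by linarith, h2⟩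
    have h4 : 0 < C * (-x) ^ ((1 + p) / (m * p - 1)) :=
      mul_pos hC (Real.rpow_pos_of_pos (by linarith) _)
    linarith
  obtain ⟨δ, h1, h2, h3⟩ := hu.exists_waitingTime hm hp hb.le hmp hT (A := 3 * C) (c := l / 2)
    (by positivity) (by linarith) hright (fun x hx hx' => (hbound x hx.le hx').le)
    (hbound _ le_rfl (by linarith))
  refine ⟨δ, h1, h2, fun t ht => le_antisymm ?_ ?_⟩
  · refine sSup_le ?_
    rintro _ ⟨x, hx, rfl⟩
    have hx : 0 < u x t := hx
    refine EReal.coe_nonpos.mpr ?_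
    by_contra! h
    exact absurd (h3 t ht x h) (not_le.mpr hx)
  -- The initial positivity set is contained in the later ones, so the supremum cannot decrease
  -- below its initial value.
  · rw [← hη]
    refine sSup_le_sSup (image_mono fun x hx => ?_)
    have hx : 0 < u x 0 := hx
    rw [hinit] at hx
    exact hu.pos_of_initial_pos hm hp hb.le hmp hβ hu₀ hx (Icc_subset_timeIco le_rfl h2 ht)
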